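/- Let $N\ge 1$, $d\ge 0$ be integers and let $\mathcal A=(a_{i_1,\dots,i_N})\in\mathbb R^{d\times\cdots\times d}$ be a tensor of order $N$ with every mode of size $d$; write $\mathrm{tr}(\mathcal A)=\sum_{i=1}^d a_{i,\dots,i}$ and $\|\mathcal A\|_F^2=\sum_{i_1,\dots,i_N}a_{i_1,\dots,i_N}^2$. Let $g^{(1)},\dots,g^{(N-1)}\in\mathbb R^d$ be random vectors all of whose entries are jointly independent with law $\mathcal N(0,1)$, let $g=g^{(1)}*\cdots*g^{(N-1)}$ be their entrywise product (the all-ones vector if $N=1$), and let $$X=g^{T}\bigl(\mathcal A\,\bar\times_1 g^{(1)}\,\bar\times_2 g^{(2)}\cdots\bar\times_{N-1}g^{(N-1)}\bigr),$$ where $\bar\times_n$ is the mode-$n$ tensor–vector product (the $n$-th index of $\mathcal A$ is summed out against the vector), so that $X$ is an estimate of $\mathrm{tr}(\mathcal A)$. (1) Each entry $z$ of each $g^{(n)}$ has $\mathbb E[z^4]=3$, $X$ has a finite second moment, and $$\mathrm{Var}(X)=\sum_{p=1}^d\Bigl(\sum_{s=0}^{N-1}3^s\sum_{\substack{(j_1,\dots,j_{N-1})\in[d]^{N-1}\\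 \#\{t:\,j_t=p\}=s}}a_{j_1,\dots,j_{N-1},p}^2-a_{p,\dots,p}^2\Bigr)+2\sum_{p>q}\Bigl(\sum_{\substack{j,k\in\{p,q\}^{N-1}\\ j_t\ne k_t\ \forall t\in[N-1]}}a_{j_1,\dots,j_{N-1},p}\,a_{k_1,\dots,k_{N-1},q}-a_{p,\dots,p}\,a_{q,\dots,q}\Bigr),$$ and $$\mathrm{Var}(X)\le(3^{N-1}-1)\,\|\mathcal A\|_F^2.$$ (2) There is an absolute constant $C>0$ (independent of $N,d,\mathcal A,\varepsilon,\delta,K$) such that the following holds for all $N$, $d$, $\mathcal A$ as above with $\mathrm{tr}(\mathcal A)\neq0$, all $\varepsilon>0$ and all $\delta\in(0,1)$. If $K\ge1$ is an integer with $$K\ \ge\ C\,\frac{(3^{N-1}-1)\,\|\mathcal A\|_F^2\,\bigl(2+\log(1/\delta)\bigr)^{2(N-1)}}{\varepsilon^2\,\mathrm{tr}(\mathcal A)^2},$$ and $\bar X$ is the mean of $K$ independent copies of $X$, formed from $K$ independent sets of vectors $g^{(1)},\dots,g^{(N-1)}$, then $\bar X$ is an $(\varepsilon,\delta)$-approximation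 of $\mathrm{tr}(\mathcal A)$, that is, $$\Pr\bigl(|\bar X-\mathrm{tr}(\mathcal A)|\le\varepsilon\,|\mathrm{tr}(\mathcal A)|\bigr)\ge1-\delta.$$ -/

import Mathlib

open MeasureTheory ProbabilityTheory

noncomputable section

namespace TensorTrace

/-- A real tensor of order `N` all of whose modes have size `d`. -/
abbrev Tensor (N d : ℕ) : Type := (Fin N → Fin d) → ℝ

/-- The trace, i.e. the sum of the diagonal entries `a_{i,…,i}`. -/
def Tensor.trace {N d : ℕ} (A : Tensor N d) : ℝ := ∑ i : Fin d, A (fun _ => i)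

/-- The Frobenius norm. -/
def Tensor.frobeniusNorm {N d : ℕ} (A : Tensor N d) : ℝ := Real.sqrt (∑ i, A i ^ 2)

/-- The mode-`n` product of a tensor with a vector: sum out the `n`-th index against `x`. -/
def Tensor.modeMul {N d : ℕ} (A : Tensor (N + 1) d) (n : Fin (N + 1)) (x : Fin d → ℝ) :
    Tensor N d :=
  fun i => ∑ l : Fin d, A (n.insertNth l i) * x l

/-- The vector obtained from a tensor of order `n + 1` by multiplying its first `n` modes, in
order, with `g 0, …, g (n - 1)`. Once a mode has been summed out the next one is first. -/
def Tensor.contract {d : ℕ} :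
    (n : ℕ) → Tensor (n + 1) d → (Fin n → Fin d → ℝ) → Fin d → ℝ
  | 0, A, _ => fun i => A (fun _ => i)
  | n + 1, A, g => Tensor.contract n (A.modeMul 0 (g 0)) (fun t => g t.succ)

/-- The Hadamard (entrywise) product of finitely many vectors. -/
def hadamard {n d : ℕ} (g : Fin n → Fin d → ℝ) : Fin d → ℝ := fun i => ∏ t, g t i

/-- The trace estimate `gᵀ (A ×₁ g⁽¹⁾ ⋯ ×ₙ g⁽ⁿ⁾)`, where `g = g⁽¹⁾ * ⋯ * g⁽ⁿ⁾`. -/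
def traceEstimate {n d : ℕ} (A : Tensor (n + 1) d) (g : Fin n → Fin d → ℝ) : ℝ :=
  ∑ p : Fin d, hadamard g p * A.contract n g p

/-- The entry `a_{j₁,…,jₙ,p}` of a tensor of order `n + 1`. -/
def Tensor.entry {n d : ℕ} (A : Tensor (n + 1) d) (j : Fin n → Fin d) (p : Fin d) : ℝ :=
  A (Fin.snoc (α := fun _ => Fin d) j p)

/-- The random variable `Y` is within relative error `ε` of `ξ` with probability at least
`1 - δ`. -/
def IsApproximation {Ω : Type*} [MeasurableSpace Ω] (μ : Measure Ω) (Y : Ω → ℝ)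
    (ξ ε δ : ℝ) : Prop :=
  1 - δ ≤ μ.real {ω | |Y ω - ξ| ≤ ε * |ξ|}

end TensorTrace

end

/-! The estimate is a polynomial in independent Gaussians: `traceFn` is the sum over pairs `(j, p)`
of `a_{j,p} ∏ₜ x(t, jₜ) x(t, p)`. Its degree is `2n`, with `n = N - 1`, and no variable occurs
beyond its square.

Variance. The mean of a product of two such monomials factors over `t`, and each factor is a
fourth-order Gaussian moment given by Isserlis' formula (`integral_traceMonomial_mul`). Sorting the
pairs by their last indices `(p, q)` gives the exact formula: `p = q` forces `j = k` with a factor 3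
for every `jₜ = p`, while `p ≠ q` forces `{jₜ, kₜ} = {p, q}` for every `t`. For the bound, the
covariance matrix of the monomials is symmetric with nonnegative entries and its row sums are at
most `3^n - 1` (`sum_covariance_le`), so the Schur test applies to the quadratic form in the entries
of `A`.

Concentration. Gaussian hypercontractivity is proved for polynomials of degree at most two in each
variable: damping each Hermite product by `ρ^degree`, `ρ² = 1/(72k)`, maps `L²` contractively into
`L^{2k}`. The case of one variable (`integral_hermite_pow_le`) comes from symmetrization and moment
bounds; Minkowski's inequality gives the induction on the number of variables. Undoing the damping
yields `E f^{2k} ≤ ((72k)^m E f²)^k` in degree `m`. Applied to the centred mean of `K` copies, which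
still has degree `2n` but a variance `K` times smaller, together with Markov's inequality for `k` of
order `log(1/δ)`, this gives the sample size. -/

noncomputable section

namespace TensorTrace

/-! ### Functions with moments of all orders -/

/-- A function that lies in every `L^p`, `p < ∞`. -/
def HasAllMoments {Ω : Type*} [MeasurableSpace Ω] (f : Ω → ℝ) (μ : Measure Ω) : Prop :=
  ∀ p : NNReal, MemLp f p μ

namespace HasAllMoments

variable {Ω : Type*} [MeasurableSpace Ω] {μ : Measure Ω} {f g : Ω → ℝ}

lemma const [IsFiniteMeasure μ] (a : ℝ) : HasAllMoments (fun _ => a) μ :=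
  fun _ => memLp_const a

lemma add (hf : HasAllMoments f μ) (hg : HasAllMoments g μ) :
    HasAllMoments (fun x => f x + g x) μ :=
  fun p => (hf p).add (hg p)

/-- Hölder with both exponents `2p`. Closure under products, which fails for a single `L^p`, makes
every polynomial in Gaussians integrable. -/
lemma mul (hf : HasAllMoments f μ) (hg : HasAllMoments g μ) :
    HasAllMoments (fun x => f x * g x) μ := by
  intro p
  have : ENNReal.HolderTriple ((2 * p : NNReal) : ENNReal) ((2 * p : NNReal) : ENNReal) p := by
    constructor
    push_cast
    rw [ENNReal.mul_inv (by simp) (by simp), ← add_mul, ENNReal.inv_two_add_inv_two, one_mul]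
  exact MemLp.mul (hg (2 * p)) (hf (2 * p))

lemma const_mul (hf : HasAllMoments f μ) (a : ℝ) : HasAllMoments (fun x => a * f x) μ :=
  fun p => (hf p).const_mul a

lemma sub (hf : HasAllMoments f μ) (hg : HasAllMoments g μ) :
    HasAllMoments (fun x => f x - g x) μ :=
  fun p => (hf p).sub (hg p)

lemma pow [IsFiniteMeasure μ] (hf : HasAllMoments f μ) (n : ℕ) :
    HasAllMoments (fun x => f x ^ n) μ := by
  induction n with
  | zero => simpa using const 1
  | succ n ih => simpa [pow_succ] using ih.mul hf

lemma sum [IsFiniteMeasure μ] {ι : Type*} (s : Finset ι) {F : ι → Ω → ℝ}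
    (hF : ∀ i ∈ s, HasAllMoments (F i) μ) : HasAllMoments (fun x => ∑ i ∈ s, F i x) μ :=
  fun p => memLp_finsetSum s fun i hi => hF i hi p

lemma prod [IsFiniteMeasure μ] {ι : Type*} (s : Finset ι) {F : ι → Ω → ℝ}
    (hF : ∀ i ∈ s, HasAllMoments (F i) μ) : HasAllMoments (fun x => ∏ i ∈ s, F i x) μ := by
  classical
  induction s using Finset.induction_on with
  | empty => simpa using const 1
  | insert a s ha ih =>
    simp only [Finset.prod_insert ha]
    exact (hF a (by simp)).mul (ih fun i hi => hF i (by simp [hi]))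

lemma memLp_two (hf : HasAllMoments f μ) : MemLp f 2 μ := by
  simpa using hf 2

lemma integrable (hf : HasAllMoments f μ) : Integrable f μ := by
  rw [← memLp_one_iff_integrable]
  simpa using hf 1

lemma comp_hasLaw {Ω' : Type*} [MeasurableSpace Ω'] {P : Measure Ω'} {X : Ω' → Ω}
    (hf : HasAllMoments f μ) (hX : HasLaw X μ P) : HasAllMoments (fun ω => f (X ω)) P := by
  intro p
  have h := hf p
  rw [← hX.map_eq] at h
  exact h.comp_of_map hX.aemeasurable

end HasAllMoments

/-! ### Moments of the standard Gaussian -/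

lemma hasAllMoments_gaussian : HasAllMoments (fun x : ℝ => x) (gaussianReal 0 1) :=
  fun p => memLp_id_gaussianReal p

lemma hasAllMoments_of_hasLaw_gaussian {Ω : Type*} [MeasurableSpace Ω] {P : Measure Ω}
    {X : Ω → ℝ} (hX : HasLaw X (gaussianReal 0 1) P) : HasAllMoments X P :=
  hasAllMoments_gaussian.comp_hasLaw hX

lemma integrable_gaussianPDFReal_mul_pow (n : ℕ) :
    Integrable (fun x => gaussianPDFReal 0 1 x * x ^ n) := by
  have h := (hasAllMoments_gaussian.pow n).integrable
  rw [gaussianReal_of_var_ne_zero _ one_ne_zero,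
    integrable_withDensity_iff_integrable_smul' (measurable_gaussianPDF 0 1)
      (ae_of_all _ fun _ => gaussianPDF_lt_top)] at h
  simpa [toReal_gaussianPDF] using h

lemma hasDerivAt_gaussianPDFReal (x : ℝ) :
    HasDerivAt (gaussianPDFReal 0 1) (-x * gaussianPDFReal 0 1 x) x := by
  have h1 : HasDerivAt (fun y : ℝ => -(y - 0) ^ 2 / (2 * ((1 : NNReal) : ℝ))) (-x) x := by
    have := ((((hasDerivAt_id x).sub_const 0).pow 2).neg).div_const (2 * ((1 : NNReal) : ℝ))
    exact this.congr_deriv (by simp; ring)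
  have h2 := (h1.exp).const_mul ((Real.sqrt (2 * Real.pi * ((1 : NNReal) : ℝ)))⁻¹)
  refine HasDerivAt.congr_deriv (f := gaussianPDFReal 0 1) h2 ?_
  rw [gaussianPDFReal_def]
  ring

/-- The moment recursion `E x^(n+2) = (n+1) E x^n`. -/
lemma integral_pow_add_two_gaussianReal (n : ℕ) :
    ∫ x, x ^ (n + 2) ∂(gaussianReal 0 1) = (n + 1) * ∫ x, x ^ n ∂(gaussianReal 0 1) := by
  -- Integration by parts: the density satisfies `φ' = -xφ`, and the integral of the derivative of
  -- `φ(y) y^(n+1)` over the line vanishes.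
  have hd : ∀ x : ℝ, HasDerivAt (fun y => gaussianPDFReal 0 1 y * y ^ (n + 1))
      ((n + 1) * (gaussianPDFReal 0 1 x * x ^ n) - gaussianPDFReal 0 1 x * x ^ (n + 2)) x := by
    intro x
    refine ((hasDerivAt_gaussianPDFReal x).mul (hasDerivAt_pow (n + 1) x)).congr_deriv ?_
    push_cast
    ring
  have h0 := integral_eq_zero_of_hasDerivAt_of_integrable hd
    (((integrable_gaussianPDFReal_mul_pow n).const_mul _).sub
      (integrable_gaussianPDFReal_mul_pow (n + 2))) (integrable_gaussianPDFReal_mul_pow (n + 1))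
  rw [integral_sub ((integrable_gaussianPDFReal_mul_pow n).const_mul _)
    (integrable_gaussianPDFReal_mul_pow (n + 2)), integral_const_mul] at h0
  rw [integral_gaussianReal_eq_integral_smul one_ne_zero,
    integral_gaussianReal_eq_integral_smul one_ne_zero]
  simp only [smul_eq_mul]
  linarith

/-- The moments of the standard Gaussian. -/
def gaussMoment (n : ℕ) : ℝ := ∫ x, x ^ n ∂(gaussianReal 0 1)

@[simp] lemma gaussMoment_zero : gaussMoment 0 = 1 := by simp [gaussMoment]
@[simp] lemma gaussMoment_one : gaussMoment 1 = 0 := by simp [gaussMoment, integral_id_gaussianReal]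
lemma gaussMoment_add_two (n : ℕ) : gaussMoment (n + 2) = (n + 1) * gaussMoment n :=
  integral_pow_add_two_gaussianReal n
@[simp] lemma gaussMoment_two : gaussMoment 2 = 1 := by
  have := gaussMoment_add_two 0
  simpa using this
@[simp] lemma gaussMoment_three : gaussMoment 3 = 0 := by
  have := gaussMoment_add_two 1
  simpa using this
@[simp] lemma gaussMoment_four : gaussMoment 4 = 3 := by
  rw [gaussMoment_add_two 2]; norm_num

lemma gaussMoment_even_pos (i : ℕ) : 1 ≤ gaussMoment (2 * i) := by
  induction i with
  | zero => simp
  | succ i ih =>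
    rw [mul_add_one, gaussMoment_add_two]
    push_cast
    nlinarith [(Nat.cast_nonneg i : (0 : ℝ) ≤ i)]

/-- The recursion is applied `i` times, from order `2i` up to `4i`; each factor `2(i+j)+1` with `j <
i ≤ k` is at most `4k`. -/
lemma gaussMoment_two_mul_even_le (i k : ℕ) (hik : i ≤ k) :
    gaussMoment (2 * (2 * i)) ≤ gaussMoment (2 * i) * (4 * k : ℝ) ^ i := by
  have key : ∀ j, j ≤ i →
      gaussMoment (2 * (i + j)) ≤ gaussMoment (2 * i) * (4 * k : ℝ) ^ j := by
    intro j
    induction j with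
    | zero => simp
    | succ j ih =>
      intro hj
      have h1 := ih (by omega)
      rw [show 2 * (i + (j + 1)) = 2 * (i + j) + 2 by ring, gaussMoment_add_two, pow_succ]
      have h2 : ((2 * (i + j) : ℕ) : ℝ) + 1 ≤ 4 * k := by
        have : 2 * (i + j) + 1 ≤ 4 * k := by omega
        exact_mod_cast this
      have h3 := gaussMoment_even_pos (i + j)
      have h4 : (0 : ℝ) ≤ 4 * k := by positivity
      nlinarith [mul_le_mul_of_nonneg_right h2 (by linarith : 0 ≤ gaussMoment (2 * (i + j))),
        mul_le_mul_of_nonneg_left h1 h4]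
  have := key i le_rfl
  rwa [← two_mul] at this

/-- Ratios of consecutive terms are compared. With `m = k - i - 1`, the left side grows by
`(m+1)(2m+1)/(i+1)` and the right side by `(m+1)/(i+1) · 2k`. -/
lemma choose_two_mul_mul_gaussMoment_le (k i : ℕ) (hik : i ≤ k) :
    ((2 * k).choose (2 * i) : ℝ) * gaussMoment (2 * i) ≤ (k.choose i : ℝ) * (2 * k : ℝ) ^ i := by
  induction i with
  | zero => simp
  | succ i ih =>
    have h1 := ih (by omega)
    have e1 := Nat.choose_succ_right_eq (2 * k) (2 * i)
    have e2 := Nat.choose_succ_right_eq (2 * k) (2 * i + 1)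
    have e3 := Nat.choose_succ_right_eq k i
    obtain ⟨m, rfl⟩ : ∃ m, k = i + 1 + m := ⟨k - (i + 1), by omega⟩
    rw [show 2 * (i + 1 + m) - 2 * i = 2 * m + 2 by omega] at e1
    rw [show 2 * (i + 1 + m) - (2 * i + 1) = 2 * m + 1 by omega] at e2
    rw [show i + 1 + m - i = m + 1 by omega] at e3
    rw [mul_add_one 2 i, gaussMoment_add_two]
    replace e1 : ((2 * (i + 1 + m)).choose (2 * i + 1) : ℝ) * (2 * i + 1)
        = ((2 * (i + 1 + m)).choose (2 * i) : ℝ) * (2 * m + 2) := by exact_mod_cast e1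
    replace e2 : ((2 * (i + 1 + m)).choose (2 * i + 2) : ℝ) * (2 * i + 2)
        = ((2 * (i + 1 + m)).choose (2 * i + 1) : ℝ) * (2 * m + 1) := by exact_mod_cast e2
    replace e3 : ((i + 1 + m).choose (i + 1) : ℝ) * (i + 1)
        = ((i + 1 + m).choose i : ℝ) * (m + 1) := by exact_mod_cast e3
    set a : ℝ := (((2 * (i + 1 + m)).choose (2 * i) : ℕ) : ℝ)
    set b : ℝ := (((2 * (i + 1 + m)).choose (2 * i + 1) : ℕ) : ℝ)
    set c : ℝ := (((2 * (i + 1 + m)).choose (2 * i + 2) : ℕ) : ℝ)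
    set u : ℝ := (((i + 1 + m).choose i : ℕ) : ℝ)
    set v : ℝ := (((i + 1 + m).choose (i + 1) : ℕ) : ℝ)
    set g := gaussMoment (2 * i)
    have hg : 1 ≤ g := gaussMoment_even_pos i
    have hi : (0 : ℝ) < i + 1 := by positivity
    push_cast at h1 ⊢
    set T : ℝ := 2 * (i + 1 + m)
    have hT : (2 * m + 1 : ℝ) ≤ T := by simp only [T]; linarith [(Nat.cast_nonneg i : (0 : ℝ) ≤ i)]
    have e4 : c * ((2 * i + 1) * g) * (i + 1) = (a * g) * (2 * m + 1) * (m + 1) := by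
      have : c * (2 * i + 2) * (2 * i + 1) = a * (2 * m + 2) * (2 * m + 1) := by
        rw [e2, ← e1]; ring
      linear_combination (g / 2) * this
    have hu : 0 ≤ u * T ^ i := by positivity
    have hm : (0 : ℝ) ≤ m + 1 := by positivity
    refine le_of_mul_le_mul_right ?_ hi
    rw [e4]
    calc a * g * (2 * m + 1) * (m + 1) ≤ (u * T ^ i) * T * (m + 1) := by gcongr
      _ = v * T ^ (i + 1) * (i + 1) := by rw [pow_succ]; linear_combination -(T ^ i * T) * e3

/-! ### One-dimensional hypercontractivity -/

/-- A convexity form of symmetrization. -/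
lemma add_pow_even_le_symmetrized (m : ℕ) (a y : ℝ) :
    (a + y) ^ (2 * m + 2) ≤ (2 * m + 2) * a ^ (2 * m + 1) * y +
      ((a + 2 * y) ^ (2 * m + 2) + (a - 2 * y) ^ (2 * m + 2)) / 2 := by
  set φ : ℝ → ℝ := fun y => (2 * m + 2) * a ^ (2 * m + 1) * y +
      ((a + 2 * y) ^ (2 * m + 2) + (a - 2 * y) ^ (2 * m + 2)) / 2 - (a + y) ^ (2 * m + 2) with hφ
  set φ₁ : ℝ → ℝ := fun y => (2 * m + 2) * (a ^ (2 * m + 1) + (a + 2 * y) ^ (2 * m + 1)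
    - (a - 2 * y) ^ (2 * m + 1) - (a + y) ^ (2 * m + 1)) with hφ₁
  set φ₂ : ℝ → ℝ := fun y => (2 * m + 2) * (2 * m + 1) * (2 * (a + 2 * y) ^ (2 * m)
    + 2 * (a - 2 * y) ^ (2 * m) - (a + y) ^ (2 * m)) with hφ₂
  have hp : ∀ y : ℝ, HasDerivAt (fun y : ℝ => a + 2 * y) 2 y := fun y => by
    simpa using ((hasDerivAt_id y).const_mul 2).const_add a
  have hm : ∀ y : ℝ, HasDerivAt (fun y : ℝ => a - 2 * y) (-2) y := fun y => by
    simpa using ((hasDerivAt_id y).const_mul 2).const_sub a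
  have h1 : ∀ y : ℝ, HasDerivAt (fun y : ℝ => a + y) 1 y := fun y => by
    simpa using (hasDerivAt_id y).const_add a
  have d1 : ∀ y, HasDerivAt φ (φ₁ y) y := by
    intro y
    refine (((((hasDerivAt_id y).const_mul ((2 * m + 2) * a ^ (2 * m + 1))).add
      ((((hp y).pow (2 * m + 2)).add ((hm y).pow (2 * m + 2))).div_const 2)).sub
      ((h1 y).pow (2 * m + 2)))).congr_deriv ?_
    simp only [hφ₁]
    push_cast
    ring
  have d2 : ∀ y, HasDerivAt φ₁ (φ₂ y) y := by
    intro y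
    refine ((((((hp y).pow (2 * m + 1)).const_add (a ^ (2 * m + 1))).sub
      ((hm y).pow (2 * m + 1))).sub ((h1 y).pow (2 * m + 1))).const_mul
        (2 * (m : ℝ) + 2)).congr_deriv ?_
    simp only [hφ₂]
    push_cast
    ring
  have e1 : deriv φ = φ₁ := funext fun y => (d1 y).deriv
  have e2 : deriv φ₁ = φ₂ := funext fun y => (d2 y).deriv
  -- The difference `φ` of the two sides vanishes at 0 together with its derivative, so convexity in
  -- `y` suffices. When `Y` has mean zero the linear term integrates away and only even powers of
  -- `2Y` remain.
  have hconv : ConvexOn ℝ Set.univ φ := by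
    refine convexOn_univ_of_deriv2_nonneg (fun y => (d1 y).differentiableAt)
      (by rw [e1]; exact fun y => (d2 y).differentiableAt) fun y => ?_
    rw [Function.iterate_succ, Function.iterate_one, Function.comp_apply, e1, e2]
    simp only [hφ₂]
    have hsq : (a + y) ^ (2 * m) ≤ (a + 2 * y) ^ (2 * m) + (a - 2 * y) ^ (2 * m) := by
      simp only [pow_mul]
      rcases le_total 0 (a * y) with h | h
      · have : (a + y) ^ 2 ≤ (a + 2 * y) ^ 2 := by nlinarith [sq_nonneg y]
        have := pow_le_pow_left₀ (sq_nonneg _) this m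
        have : 0 ≤ ((a - 2 * y) ^ 2) ^ m := by positivity
        linarith
      · have : (a + y) ^ 2 ≤ (a - 2 * y) ^ 2 := by nlinarith [sq_nonneg y]
        have := pow_le_pow_left₀ (sq_nonneg _) this m
        have : 0 ≤ ((a + 2 * y) ^ 2) ^ m := by positivity
        linarith
    have n1 : 0 ≤ (a + 2 * y) ^ (2 * m) := (even_two_mul m).pow_nonneg _
    have n2 : 0 ≤ (a - 2 * y) ^ (2 * m) := (even_two_mul m).pow_nonneg _
    apply mul_nonneg (by positivity)
    linarith
  have hmin : IsMinOn φ Set.univ 0 := by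
    apply hconv.isMinOn_of_rightDeriv_eq_zero (by simp)
    rw [(d1 0).hasDerivWithinAt.derivWithin (uniqueDiffWithinAt_Ioi 0)]
    simp [hφ₁]
  have h := hmin (Set.mem_univ y)
  simp only [Set.mem_ofPred_eq, hφ] at h
  simp only [mul_zero, add_zero, sub_zero] at h
  linarith

lemma sum_range_two_mul_add_one_eq_sum_even (f : ℕ → ℝ) (hf : ∀ i, f (2 * i + 1) = 0) (k : ℕ) :
    ∑ j ∈ Finset.range (2 * k + 1), f j = ∑ i ∈ Finset.range (k + 1), f (2 * i) := by
  induction k with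
  | zero => simp
  | succ k ih =>
    rw [show 2 * (k + 1) + 1 = 2 * k + 1 + 1 + 1 by ring, Finset.sum_range_succ,
      Finset.sum_range_succ, ih, hf, Finset.sum_range_succ _ (k + 1), add_zero]
    rfl

lemma add_pow_add_sub_pow_div_two (k : ℕ) (a z : ℝ) :
    ((a + z) ^ (2 * k) + (a - z) ^ (2 * k)) / 2 =
      ∑ i ∈ Finset.range (k + 1), ((2 * k).choose (2 * i) : ℝ) * (a ^ 2) ^ (k - i) * z ^ (2 * i) := by
  have h := sum_range_two_mul_add_one_eq_sum_even
    (fun j => (z ^ j + (-z) ^ j) / 2 * a ^ (2 * k - j) * ((2 * k).choose j : ℝ))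
    (fun i => by simp [Odd.neg_pow (⟨i, rfl⟩ : Odd (2 * i + 1))]) k
  rw [add_comm a z, sub_eq_add_neg, add_comm a (-z), add_pow, add_pow, ← Finset.sum_add_distrib,
    Finset.sum_div]
  refine Eq.trans (Finset.sum_congr rfl fun j _ => ?_) (h.trans (Finset.sum_congr rfl fun i _ => ?_))
  · ring
  · rw [(even_two_mul i).neg_pow, ← pow_mul, Nat.mul_sub]
    ring

/-- The Hermite polynomials of degree at most two, orthonormal under the standard Gaussian. -/
def hermiteFn (r : Fin 3) (x : ℝ) : ℝ := ![1, x, (x ^ 2 - 1) / √2] r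

@[simp] lemma hermiteFn_zero (x : ℝ) : hermiteFn 0 x = 1 := rfl
@[simp] lemma hermiteFn_one (x : ℝ) : hermiteFn 1 x = x := rfl
lemma hermiteFn_two (x : ℝ) : hermiteFn 2 x = (x ^ 2 - 1) / √2 := rfl

lemma hasAllMoments_hermiteFn (r : Fin 3) : HasAllMoments (hermiteFn r) (gaussianReal 0 1) := by
  fin_cases r
  · exact HasAllMoments.const 1
  · exact hasAllMoments_gaussian
  · have h := ((hasAllMoments_gaussian.pow 2).sub (HasAllMoments.const 1)).const_mul (√2)⁻¹
    convert h using 2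
    simp only [Fin.reduceFinMk, hermiteFn_two]
    ring

lemma integral_hermiteFn_two : ∫ x, hermiteFn 2 x ∂(gaussianReal 0 1) = 0 := by
  simp only [hermiteFn_two]
  rw [integral_div, integral_sub (hasAllMoments_gaussian.pow 2).integrable (integrable_const _)]
  have := gaussMoment_two
  simp [gaussMoment] at this
  simp [this]

lemma integral_hermiteFn_mul (r s : Fin 3) :
    ∫ x, hermiteFn r x * hermiteFn s x ∂(gaussianReal 0 1) = if r = s then 1 else 0 := by
  have h1 : ∫ x, x ∂(gaussianReal 0 1) = 0 := integral_id_gaussianReal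
  have h2 : ∫ x, x ^ 2 ∂(gaussianReal 0 1) = 1 := gaussMoment_two
  have h3 : ∫ x, x ^ 3 ∂(gaussianReal 0 1) = 0 := gaussMoment_three
  have h4 : ∫ x, x ^ 4 ∂(gaussianReal 0 1) = 3 := gaussMoment_four
  have i1 := hasAllMoments_gaussian.integrable
  have i2 := (hasAllMoments_gaussian.pow 2).integrable
  have i3 := (hasAllMoments_gaussian.pow 3).integrable
  have i4 := (hasAllMoments_gaussian.pow 4).integrable
  have h12 : ∫ x, x * hermiteFn 2 x ∂(gaussianReal 0 1) = 0 := by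
    have : ∀ x : ℝ, x * hermiteFn 2 x = (x ^ 3 - x) / √2 := fun x => by rw [hermiteFn_two]; ring
    simp only [this]
    rw [integral_div, integral_sub i3 i1, h3, h1]
    simp
  have h22 : ∫ x, hermiteFn 2 x * hermiteFn 2 x ∂(gaussianReal 0 1) = 1 := by
    have : ∀ x : ℝ, hermiteFn 2 x * hermiteFn 2 x = (x ^ 4 - 2 * x ^ 2 + 1) / 2 := fun x => by
      rw [hermiteFn_two, div_mul_div_comm, Real.mul_self_sqrt (by norm_num)]; ring
    simp only [this]
    rw [integral_div, integral_add ((hasAllMoments_gaussian.pow 4).sub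
      ((hasAllMoments_gaussian.pow 2).const_mul 2)).integrable (integrable_const _),
      integral_sub i4 (i2.const_mul 2), integral_const_mul, h4, h2]
    norm_num
  fin_cases r <;> fin_cases s <;>
    simp [h1, ← pow_two, h2, h12, integral_hermiteFn_two, mul_comm (hermiteFn 2 _)]
  · simpa [pow_two] using h22

/-- The sum is at most three times its largest term; the loss `3^i` is absorbed later by the
constant 72. -/
lemma add_add_pow_le (u v w : ℝ) (hu : 0 ≤ u) (hv : 0 ≤ v) (hw : 0 ≤ w) (i : ℕ) :
    (u + v + w) ^ i ≤ 3 ^ i * (u ^ i + v ^ i + w ^ i) := by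
  have hu' := pow_nonneg hu i
  have hv' := pow_nonneg hv i
  have hw' := pow_nonneg hw i
  have key : ∀ m : ℝ, 0 ≤ m → u ≤ m → v ≤ m → w ≤ m → (u + v + w) ^ i ≤ 3 ^ i * m ^ i := by
    intro m hm h1 h2 h3
    rw [← mul_pow]
    exact pow_le_pow_left₀ (by positivity) (by linarith) i
  have h3 : (0 : ℝ) ≤ 3 ^ i := by positivity
  rcases le_total u v with h1 | h1 <;> rcases le_total v w with h2 | h2 <;>
    rcases le_total u w with h4 | h4
  all_goals first
    | exact (key u hu (by linarith) (by linarith) (by linarith)).trans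
        (mul_le_mul_of_nonneg_left (by linarith) h3)
    | exact (key v hv (by linarith) (by linarith) (by linarith)).trans
        (mul_le_mul_of_nonneg_left (by linarith) h3)
    | exact (key w hw (by linarith) (by linarith) (by linarith)).trans
        (mul_le_mul_of_nonneg_left (by linarith) h3)

/-- Term-by-term comparison for `integral_hermite_pow_le`: the `i`-th even term of the symmetrized
expansion is bounded by the `i`-th binomial term of `(a² + (b² + c²))^k`, the powers of `a²` being
common to both. -/
lemma choose_mul_integral_le (k i : ℕ) (hk : 1 ≤ k) (hik : i ≤ k) (ρ : ℝ) (hρ : ρ ^ 2 * (72 * k) = 1)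
    (b c : ℝ) :
    ((2 * k).choose (2 * i) : ℝ) *
      ∫ x, (2 * (b * (ρ * x) + c * (ρ ^ 2 * hermiteFn 2 x))) ^ (2 * i) ∂(gaussianReal 0 1) ≤
      (k.choose i : ℝ) * (b ^ 2 + c ^ 2) ^ i := by
  -- The case `i = 0` is an equality and must be separated: the factor 3 below is absorbed only when
  -- `i ≥ 1`.
  rcases Nat.eq_zero_or_pos i with rfl | hi
  · simp
  have hk' : (1 : ℝ) ≤ k := by exact_mod_cast hk
  have hρ2 : 0 ≤ ρ ^ 2 := sq_nonneg _
  have hρk : ρ ^ 2 * k = 1 / 72 := by linarith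
  have hρ1 : ρ ^ 2 ≤ 1 / 72 := by nlinarith
  have ia : HasAllMoments (fun x : ℝ => b * (ρ * x) + c * (ρ ^ 2 * hermiteFn 2 x))
      (gaussianReal 0 1) :=
    ((hasAllMoments_gaussian.const_mul ρ).const_mul b).add
      (((hasAllMoments_hermiteFn 2).const_mul _).const_mul c)
  have i1 := (hasAllMoments_gaussian.pow (2 * i)).const_mul ((ρ ^ 2) ^ i)
  have i2 := (hasAllMoments_gaussian.pow (2 * (2 * i))).const_mul ((ρ ^ 4 / 2) ^ i)
  set s := b ^ 2 + c ^ 2 with hs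
  have hs0 : 0 ≤ s := by positivity
  have hpt : ∀ x : ℝ, (2 * (b * (ρ * x) + c * (ρ ^ 2 * hermiteFn 2 x))) ^ (2 * i) ≤
      (12 * s) ^ i * ((ρ ^ 2) ^ i * x ^ (2 * i) + (ρ ^ 4 / 2) ^ i * x ^ (2 * (2 * i))
        + (ρ ^ 4 / 2) ^ i) := by
    intro x
    have hh : hermiteFn 2 x ^ 2 = (x ^ 2 - 1) ^ 2 / 2 := by
      rw [hermiteFn_two, div_pow, Real.sq_sqrt (by norm_num)]
    have hb : (2 * (b * (ρ * x) + c * (ρ ^ 2 * hermiteFn 2 x))) ^ 2 ≤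
        4 * s * (ρ ^ 2 * x ^ 2 + ρ ^ 4 / 2 * x ^ 4 + ρ ^ 4 / 2) := by
      -- Cauchy–Schwarz isolates `b² + c²`; afterwards the negative cross term of `(x² - 1)²` is
      -- dropped, leaving three monomials.
      have cs : (b * (ρ * x) + c * (ρ ^ 2 * hermiteFn 2 x)) ^ 2 ≤
          s * ((ρ * x) ^ 2 + (ρ ^ 2 * hermiteFn 2 x) ^ 2) := by
        rw [hs]
        nlinarith [sq_nonneg (b * (ρ ^ 2 * hermiteFn 2 x) - c * (ρ * x))]
      have h2 : (ρ * x) ^ 2 + (ρ ^ 2 * hermiteFn 2 x) ^ 2 ≤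
          ρ ^ 2 * x ^ 2 + ρ ^ 4 / 2 * x ^ 4 + ρ ^ 4 / 2 := by
        rw [mul_pow, mul_pow, hh]
        have : 0 ≤ ρ ^ 4 * x ^ 2 := by positivity
        nlinarith
      nlinarith [mul_le_mul_of_nonneg_left h2 hs0]
    rw [pow_mul]
    calc _ ≤ (4 * s * (ρ ^ 2 * x ^ 2 + ρ ^ 4 / 2 * x ^ 4 + ρ ^ 4 / 2)) ^ i :=
          pow_le_pow_left₀ (sq_nonneg _) hb i
      _ ≤ (4 * s) ^ i * (3 ^ i * ((ρ ^ 2 * x ^ 2) ^ i + (ρ ^ 4 / 2 * x ^ 4) ^ i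
            + (ρ ^ 4 / 2) ^ i)) := by
          rw [mul_pow]
          exact mul_le_mul_of_nonneg_left
            (add_add_pow_le _ _ _ (by positivity) (by positivity) (by positivity) i) (by positivity)
      _ = _ := by
          rw [mul_pow (ρ ^ 2), mul_pow (ρ ^ 4 / 2), ← pow_mul x, ← pow_mul x,
            show (12 * s) = 4 * s * 3 by ring, mul_pow (4 * s) 3,
            show 2 * (2 * i) = 4 * i by ring]
          ring
  have hint : ∫ x, (2 * (b * (ρ * x) + c * (ρ ^ 2 * hermiteFn 2 x))) ^ (2 * i) ∂(gaussianReal 0 1) ≤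
      (12 * s) ^ i * ((ρ ^ 2) ^ i * gaussMoment (2 * i) + (ρ ^ 4 / 2) ^ i * gaussMoment (2 * (2 * i))
        + (ρ ^ 4 / 2) ^ i) := by
    refine (integral_mono ((ia.const_mul 2).pow _).integrable
      (((i1.add i2).add (HasAllMoments.const _)).const_mul _).integrable hpt).trans (le_of_eq ?_)
    rw [integral_const_mul, integral_add (i1.add i2).integrable (integrable_const _),
      integral_add i1.integrable i2.integrable,
      integral_const_mul, integral_const_mul]
    simp [gaussMoment]
  have hg := gaussMoment_even_pos i
  -- Lowering the moment from order `4i` to `2i` costs `(4k)^i`, which the extra `ρ²` pays for. All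
  -- three terms of `hint` are thus at most `(ρ²)^i` times the moment of order `2i`.
  have hv : (ρ ^ 4 / 2) ^ i * gaussMoment (2 * (2 * i)) ≤ (ρ ^ 2) ^ i * gaussMoment (2 * i) := by
    calc _ ≤ (ρ ^ 4 / 2) ^ i * (gaussMoment (2 * i) * (4 * k : ℝ) ^ i) :=
          mul_le_mul_of_nonneg_left (gaussMoment_two_mul_even_le i k hik) (by positivity)
      _ = (ρ ^ 4 / 2 * (4 * k)) ^ i * gaussMoment (2 * i) := by rw [mul_pow (ρ ^ 4 / 2)]; ring
      _ ≤ _ := by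
          refine mul_le_mul_of_nonneg_right (pow_le_pow_left₀ (by positivity) ?_ i) (by linarith)
          nlinarith
  have hw : (ρ ^ 4 / 2) ^ i ≤ (ρ ^ 2) ^ i * gaussMoment (2 * i) := by
    have : (ρ ^ 4 / 2) ^ i ≤ (ρ ^ 2) ^ i := pow_le_pow_left₀ (by positivity) (by nlinarith) i
    nlinarith [pow_nonneg hρ2 i]
  -- Origin of 72: it makes `24kρ²` equal to `1/3`, so the factor 3 from the three terms is absorbed
  -- for `i ≥ 1`.
  have hfin : 3 * (24 * k * ρ ^ 2) ^ i ≤ (1 : ℝ) := by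
    rw [show 24 * k * ρ ^ 2 = (1 : ℝ) / 3 by linarith]
    calc 3 * (1 / 3 : ℝ) ^ i ≤ 3 * (1 / 3 : ℝ) ^ 1 :=
          mul_le_mul_of_nonneg_left (pow_le_pow_of_le_one (by norm_num) (by norm_num) hi) (by norm_num)
      _ = 1 := by norm_num
  calc _ ≤ ((2 * k).choose (2 * i) : ℝ) * ((12 * s) ^ i * (3 * ((ρ ^ 2) ^ i * gaussMoment (2 * i)))) := by
        refine mul_le_mul_of_nonneg_left (hint.trans ?_) (by positivity)
        exact mul_le_mul_of_nonneg_left (by linarith) (by positivity)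
    _ = ((2 * k).choose (2 * i) * gaussMoment (2 * i)) * (3 * (12 * s * ρ ^ 2) ^ i) := by
        rw [mul_pow (12 * s)]; ring
    _ ≤ (k.choose i * (2 * k : ℝ) ^ i) * (3 * (12 * s * ρ ^ 2) ^ i) :=
        mul_le_mul_of_nonneg_right (choose_two_mul_mul_gaussMoment_le k i hik) (by positivity)
    _ = (k.choose i * s ^ i) * (3 * (24 * k * ρ ^ 2) ^ i) := by
        rw [show 24 * k * ρ ^ 2 = (2 * k) * (12 * ρ ^ 2) by ring, mul_pow (2 * (k : ℝ)),
          show 12 * s * ρ ^ 2 = s * (12 * ρ ^ 2) by ring, mul_pow s]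
        ring
    _ ≤ (k.choose i * s ^ i) * 1 := mul_le_mul_of_nonneg_left hfin (by positivity)
    _ = _ := mul_one _

/-- Hypercontractivity for polynomials of degree at most two in one Gaussian variable. -/
lemma integral_hermite_pow_le (k : ℕ) (hk : 1 ≤ k) (ρ : ℝ) (hρ : ρ ^ 2 * (72 * k) = 1) (a b c : ℝ) :
    ∫ x, (a + b * (ρ * x) + c * (ρ ^ 2 * hermiteFn 2 x)) ^ (2 * k) ∂(gaussianReal 0 1) ≤
      (a ^ 2 + b ^ 2 + c ^ 2) ^ k := by
  set Y : ℝ → ℝ := fun x => b * (ρ * x) + c * (ρ ^ 2 * hermiteFn 2 x) with hY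
  have hb := ((hasAllMoments_gaussian.const_mul ρ).const_mul b)
  have hc := (((hasAllMoments_hermiteFn 2).const_mul (ρ ^ 2)).const_mul c)
  have ia : HasAllMoments Y (gaussianReal 0 1) := hb.add hc
  have h0 : ∫ x, Y x ∂(gaussianReal 0 1) = 0 := by
    rw [hY, integral_add hb.integrable hc.integrable, integral_const_mul, integral_const_mul,
      integral_const_mul, integral_const_mul, integral_hermiteFn_two]
    simp [integral_id_gaussianReal]
  obtain ⟨m, rfl⟩ : ∃ m, k = m + 1 := ⟨k - 1, by omega⟩
  have hpt : ∀ x, (a + b * (ρ * x) + c * (ρ ^ 2 * hermiteFn 2 x)) ^ (2 * (m + 1)) ≤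
      (2 * m + 2) * a ^ (2 * m + 1) * Y x + ∑ i ∈ Finset.range (m + 1 + 1),
        ((2 * (m + 1)).choose (2 * i) : ℝ) * (a ^ 2) ^ (m + 1 - i) * (2 * Y x) ^ (2 * i) := by
    intro x
    rw [← add_pow_add_sub_pow_div_two, add_assoc]
    exact add_pow_even_le_symmetrized m a (Y x)
  have it : ∀ i ∈ Finset.range (m + 1 + 1), HasAllMoments (fun x =>
      ((2 * (m + 1)).choose (2 * i) : ℝ) * (a ^ 2) ^ (m + 1 - i) * (2 * Y x) ^ (2 * i))
      (gaussianReal 0 1) := fun i _ => ((ia.const_mul 2).pow _).const_mul _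
  refine (integral_mono (((HasAllMoments.const a).add hb).add hc |>.pow _).integrable
    ((ia.const_mul _).add (HasAllMoments.sum _ it)).integrable hpt).trans ?_
  rw [integral_add (ia.const_mul _).integrable (HasAllMoments.sum _ it).integrable,
    integral_const_mul, h0, mul_zero, zero_add, integral_finsetSum _ fun i hi => (it i hi).integrable,
    add_assoc (a ^ 2), add_comm (a ^ 2), add_pow]
  refine Finset.sum_le_sum fun i hi => ?_
  rw [integral_const_mul]
  have := choose_mul_integral_le (m + 1) i hk (by simpa [Nat.lt_succ_iff] using hi) ρ hρ b c
  have h2 := mul_le_mul_of_nonneg_right this (by positivity : 0 ≤ (a ^ 2) ^ (m + 1 - i))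
  calc _ = _ := by ring
    _ ≤ _ := h2
    _ = _ := by ring

/-! ### Gaussian hypercontractivity in several variables -/

/-- A form of Minkowski's inequality for integer exponents. -/
lemma integral_add_pow_le {Ω : Type*} [MeasurableSpace Ω] {μ : Measure Ω} [IsFiniteMeasure μ]
    {G H : Ω → ℝ} (hG : HasAllMoments G μ) (hH : HasAllMoments H μ) (hG0 : ∀ x, 0 ≤ G x)
    (hH0 : ∀ x, 0 ≤ H x) {s t : ℝ} (hs : 0 ≤ s) (ht : 0 ≤ t) (k : ℕ)
    (hGs : ∫ x, G x ^ k ∂μ ≤ s ^ k) (hHt : ∫ x, H x ^ k ∂μ ≤ t ^ k) :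
    ∫ x, (G x + H x) ^ k ∂μ ≤ (s + t) ^ k := by
  -- The shift by `ε` makes both bounds positive, so that `G` and `H` can be divided by them; it is
  -- removed by a limit.
  have key : ∀ ε : ℝ, 0 < ε → ∫ x, (G x + H x) ^ k ∂μ ≤ (s + ε + (t + ε)) ^ k := by
    intro ε hε
    have hs' : 0 < s + ε := by linarith
    have ht' : 0 < t + ε := by linarith
    have hGs' : ∫ x, G x ^ k ∂μ ≤ (s + ε) ^ k := hGs.trans (pow_le_pow_left₀ hs (by linarith) k)
    have hHt' : ∫ x, H x ^ k ∂μ ≤ (t + ε) ^ k := hHt.trans (pow_le_pow_left₀ ht (by linarith) k)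
    set S := s + ε
    set T := t + ε
    have hST : 0 < S + T := by linarith
    set A : ℝ := (S + T) ^ k * (S / (S + T)) / S ^ k with hA
    set B : ℝ := (S + T) ^ k * (T / (S + T)) / T ^ k with hB
    have hpt : ∀ x, (G x + H x) ^ k ≤ A * G x ^ k + B * H x ^ k := by
      intro x
      -- Convexity of the power at the points `G/S` and `H/T`, with weights `S/(S+T)` and `T/(S+T)`.
      have h := (convexOn_pow k).2 (Set.mem_Ici.2 (div_nonneg (hG0 x) hs'.le))
        (Set.mem_Ici.2 (div_nonneg (hH0 x) ht'.le)) (div_nonneg hs'.le hST.le)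
        (div_nonneg ht'.le hST.le) (by rw [← add_div, div_self hST.ne'])
      simp only [smul_eq_mul] at h
      have h2 := mul_le_mul_of_nonneg_left h (pow_nonneg hST.le k)
      rw [← mul_pow] at h2
      calc _ = _ := by congr 1; field_simp
        _ ≤ _ := h2
        _ = _ := by rw [hA, hB, div_pow, div_pow]; ring
    have iG := (hG.pow k).const_mul A
    have iH := (hH.pow k).const_mul B
    refine (integral_mono ((hG.add hH).pow k).integrable (iG.add iH).integrable hpt).trans ?_
    rw [integral_add iG.integrable iH.integrable, integral_const_mul, integral_const_mul]
    have hA0 : 0 ≤ A := by positivity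
    have hB0 : 0 ≤ B := by positivity
    calc _ ≤ A * S ^ k + B * T ^ k :=
          add_le_add (mul_le_mul_of_nonneg_left hGs' hA0) (mul_le_mul_of_nonneg_left hHt' hB0)
      _ = _ := by rw [hA, hB]; field_simp
  have hlim : Filter.Tendsto (fun ε : ℝ => (s + ε + (t + ε)) ^ k) (nhdsWithin 0 (Set.Ioi 0))
      (nhds ((s + t) ^ k)) := by
    have : Continuous fun ε : ℝ => (s + ε + (t + ε)) ^ k := by fun_prop
    simpa using (this.tendsto 0).mono_left nhdsWithin_le_nhds
  exact ge_of_tendsto hlim (Filter.eventually_of_mem self_mem_nhdsWithin fun ε hε => key ε hε)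

/-- The standard Gaussian measure on `ι → ℝ`. -/
abbrev gaussPi (ι : Type*) [Fintype ι] : Measure (ι → ℝ) :=
  Measure.pi fun _ => gaussianReal 0 1

section

variable {ι : Type*} [Fintype ι]

lemma hasAllMoments_eval (i : ι) : HasAllMoments (fun x : ι → ℝ => x i) (gaussPi ι) :=
  hasAllMoments_of_hasLaw_gaussian (measurePreserving_eval (fun _ => gaussianReal 0 1) i).hasLaw

/-- Products of Hermite polynomials of degree at most two. -/
def hermiteProd (α : ι → Fin 3) (x : ι → ℝ) : ℝ := ∏ i, hermiteFn (α i) (x i)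

/-- The total degree of `hermiteProd α`. -/
def hermiteDegree (α : ι → Fin 3) : ℕ := ∑ i, (α i : ℕ)

lemma hasAllMoments_hermiteProd (α : ι → Fin 3) : HasAllMoments (hermiteProd α) (gaussPi ι) :=
  HasAllMoments.prod _ fun i _ => (hasAllMoments_hermiteFn (α i)).comp_hasLaw
    (measurePreserving_eval (fun _ => gaussianReal 0 1) i).hasLaw

lemma integral_hermiteProd_mul [DecidableEq ι] (α β : ι → Fin 3) :
    ∫ x, hermiteProd α x * hermiteProd β x ∂(gaussPi ι) = if α = β then 1 else 0 := by
  simp only [hermiteProd, ← Finset.prod_mul_distrib]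
  rw [integral_fintype_prod_eq_prod (fun i y => hermiteFn (α i) y * hermiteFn (β i) y)]
  simp only [integral_hermiteFn_mul]
  rw [Finset.prod_boole]
  simp [funext_iff]

lemma integral_sum_hermiteProd_sq [DecidableEq ι] (c : (ι → Fin 3) → ℝ) :
    ∫ x, (∑ α, c α * hermiteProd α x) ^ 2 ∂(gaussPi ι) = ∑ α, c α ^ 2 := by
  simp only [pow_two, Finset.sum_mul_sum]
  have hi : ∀ α β, HasAllMoments (fun x => c α * hermiteProd α x * (c β * hermiteProd β x))
      (gaussPi ι) := fun α β =>
    ((hasAllMoments_hermiteProd α).const_mul _).mul ((hasAllMoments_hermiteProd β).const_mul _)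
  rw [integral_finsetSum _ fun α _ => (HasAllMoments.sum _ fun β _ => hi α β).integrable]
  refine Finset.sum_congr rfl fun α _ => ?_
  rw [integral_finsetSum _ fun β _ => (hi α β).integrable]
  have : ∀ β, ∫ x, c α * hermiteProd α x * (c β * hermiteProd β x) ∂(gaussPi ι) =
      if α = β then c α * c β else 0 := by
    intro β
    simp only [mul_mul_mul_comm (c α)]
    rw [integral_const_mul, integral_hermiteProd_mul]
    simp
  simp [this]

end

lemma integral_gaussPi_succ {N : ℕ} (F : (Fin (N + 1) → ℝ) → ℝ) :
    ∫ x, F x ∂(gaussPi (Fin (N + 1))) =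
      ∫ z, F (Fin.cons z.1 z.2) ∂((gaussianReal 0 1).prod (gaussPi (Fin N))) := by
  rw [← ((measurePreserving_piFinSuccAbove (fun _ : Fin (N + 1) => gaussianReal 0 1) 0).symm
    ).integral_comp']
  simp only [MeasurableEquiv.piFinSuccAbove_symm_apply, Fin.insertNthEquiv, Equiv.coe_fn_mk,
    Fin.insertNth_zero']

/-- Induction on the number of variables. For fixed remaining variables the polynomial is quadratic
in the first one, with coefficients `F 0`, `F 1`, `F 2`, and the one-variable inequality applies.
What is left is the `k`-th moment of `F 0 ² + F 1 ² + F 2 ²`: Minkowski separates the squares, and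
the induction hypothesis bounds each. -/
lemma integral_sum_hermiteProd_pow_le_fin (k : ℕ) (hk : 1 ≤ k) (ρ : ℝ) (hρ : ρ ^ 2 * (72 * k) = 1)
    (N : ℕ) (c : (Fin N → Fin 3) → ℝ) :
    ∫ x, (∑ α, c α * (ρ ^ hermiteDegree α * hermiteProd α x)) ^ (2 * k) ∂(gaussPi (Fin N)) ≤
      (∑ α, c α ^ 2) ^ k := by
  induction N with
  | zero =>
    simp [hermiteDegree, hermiteProd, pow_mul]
  | succ N ih =>
    set F : Fin 3 → (Fin N → ℝ) → ℝ := fun r x =>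
      ∑ α, c (Fin.cons r α) * (ρ ^ hermiteDegree α * hermiteProd α x) with hF
    have hsplit : ∀ f : (Fin (N + 1) → Fin 3) → ℝ, ∑ α, f α = (∑ α, f (Fin.cons 0 α))
        + (∑ α, f (Fin.cons 1 α)) + ∑ α, f (Fin.cons 2 α) := by
      intro f
      rw [← (Fin.consEquiv fun _ => Fin 3).sum_comp, Fintype.sum_prod_type, Fin.sum_univ_three]
      rfl
    have hFm : ∀ r, HasAllMoments (F r) (gaussPi (Fin N)) := fun r =>
      HasAllMoments.sum _ fun α _ => ((hasAllMoments_hermiteProd α).const_mul _).const_mul _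
    have hpt : ∀ z : ℝ × (Fin N → ℝ),
        ∑ α, c α * (ρ ^ hermiteDegree α * hermiteProd α (Fin.cons z.1 z.2 : Fin (N + 1) → ℝ)) =
        F 0 z.2 + F 1 z.2 * (ρ * z.1) + F 2 z.2 * (ρ ^ 2 * hermiteFn 2 z.1) := by
      intro z
      rw [hsplit]
      simp only [hF, hermiteDegree, hermiteProd, Fin.sum_univ_succ, Fin.prod_univ_succ,
        Fin.cons_zero, Fin.cons_succ, hermiteFn_zero, hermiteFn_one, Finset.sum_mul]
      congr 1
      · congr 1
        · refine Finset.sum_congr rfl fun α _ => ?_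
          simp
        · refine Finset.sum_congr rfl fun α _ => ?_
          simp only [Fin.val_one, pow_add]
          ring
      · refine Finset.sum_congr rfl fun α _ => ?_
        simp only [Fin.val_two, pow_add]
        ring
    have hfst : HasLaw Prod.fst (gaussianReal 0 1) ((gaussianReal 0 1).prod (gaussPi (Fin N))) :=
      measurePreserving_fst.hasLaw
    have hsnd : HasLaw Prod.snd (gaussPi (Fin N)) ((gaussianReal 0 1).prod (gaussPi (Fin N))) :=
      measurePreserving_snd.hasLaw
    have hm : HasAllMoments (fun z : ℝ × (Fin N → ℝ) => (F 0 z.2 + F 1 z.2 * (ρ * z.1)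
        + F 2 z.2 * (ρ ^ 2 * hermiteFn 2 z.1)) ^ (2 * k))
        ((gaussianReal 0 1).prod (gaussPi (Fin N))) :=
      ((((hFm 0).comp_hasLaw hsnd).add (((hFm 1).comp_hasLaw hsnd).mul
        ((hasAllMoments_gaussian.comp_hasLaw hfst).const_mul ρ))).add
        (((hFm 2).comp_hasLaw hsnd).mul
          (((hasAllMoments_hermiteFn 2).comp_hasLaw hfst).const_mul (ρ ^ 2)))).pow _
    rw [integral_gaussPi_succ]
    simp only [hpt]
    rw [integral_prod_symm _ hm.integrable]
    have hsq : ∀ r, HasAllMoments (fun x => F r x ^ 2) (gaussPi (Fin N)) := fun r => (hFm r).pow 2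
    have hsum := ((hsq 0).add (hsq 1)).add (hsq 2)
    refine (integral_mono_of_nonneg (Filter.Eventually.of_forall fun x =>
      integral_nonneg fun y => (even_two_mul k).pow_nonneg _) (hsum.pow k).integrable
      (Filter.Eventually.of_forall fun x =>
        integral_hermite_pow_le k hk ρ hρ (F 0 x) (F 1 x) (F 2 x))).trans ?_
    rw [hsplit]
    have hr : ∀ r, ∫ x, (F r x ^ 2) ^ k ∂(gaussPi (Fin N)) ≤
        (∑ α, c (Fin.cons r α) ^ 2) ^ k := by
      intro r
      simp only [← pow_mul]
      exact ih fun α => c (Fin.cons r α)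
    exact integral_add_pow_le ((hsq 0).add (hsq 1)) (hsq 2) (fun x => by positivity)
      (fun x => by positivity) (by positivity) (by positivity) k
      (integral_add_pow_le (hsq 0) (hsq 1) (fun x => by positivity)
        (fun x => by positivity) (by positivity) (by positivity) k (hr 0) (hr 1)) (hr 2)

section

variable {ι : Type*} [Fintype ι] [DecidableEq ι]

lemma integral_sum_hermiteProd_pow_le (k : ℕ) (hk : 1 ≤ k) (ρ : ℝ) (hρ : ρ ^ 2 * (72 * k) = 1)
    (c : (ι → Fin 3) → ℝ) :
    ∫ x, (∑ α, c α * (ρ ^ hermiteDegree α * hermiteProd α x)) ^ (2 * k) ∂(gaussPi ι) ≤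
      (∑ α, c α ^ 2) ^ k := by
  let e := (Fintype.equivFin ι).symm
  have hsum : ∀ f : (ι → Fin 3) → ℝ, ∑ α, f α = ∑ α : Fin _ → Fin 3, f (α ∘ e.symm) := fun f =>
    ((e.arrowCongr (Equiv.refl (Fin 3))).sum_comp f).symm
  rw [← (measurePreserving_piCongrLeft (fun _ : ι => gaussianReal 0 1) e).integral_comp']
  simp only [hsum]
  refine (le_of_eq ?_).trans (integral_sum_hermiteProd_pow_le_fin k hk ρ hρ _ _)
  refine integral_congr_ae (Filter.Eventually.of_forall fun x => ?_)
  simp only [hermiteDegree, hermiteProd, ← e.sum_comp, ← e.prod_comp,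
    MeasurableEquiv.coe_piCongrLeft, Equiv.piCongrLeft_apply_apply, Function.comp_apply,
    Equiv.symm_apply_apply]

/-- A polynomial of degree at most `m`, and of degree at most two in each variable. -/
def IsPolyOfDegreeLE (m : ℕ) (f : (ι → ℝ) → ℝ) : Prop :=
  ∃ c : (ι → Fin 3) → ℝ, (∀ α, m < hermiteDegree α → c α = 0) ∧
    ∀ x, f x = ∑ α, c α * hermiteProd α x

lemma IsPolyOfDegreeLE.hasAllMoments {m : ℕ} {f : (ι → ℝ) → ℝ} (hf : IsPolyOfDegreeLE m f) :
    HasAllMoments f (gaussPi ι) := by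
  obtain ⟨c, -, h⟩ := hf
  rw [funext h]
  exact HasAllMoments.sum _ fun α _ => (hasAllMoments_hermiteProd α).const_mul _

lemma IsPolyOfDegreeLE.add {m : ℕ} {f g : (ι → ℝ) → ℝ} (hf : IsPolyOfDegreeLE m f)
    (hg : IsPolyOfDegreeLE m g) : IsPolyOfDegreeLE m (fun x => f x + g x) := by
  obtain ⟨c, hc, h⟩ := hf
  obtain ⟨c', hc', h'⟩ := hg
  refine ⟨fun α => c α + c' α, fun α hα => by simp [hc α hα, hc' α hα], fun x => ?_⟩
  simp [h, h', add_mul, Finset.sum_add_distrib]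

lemma IsPolyOfDegreeLE.const_mul {m : ℕ} {f : (ι → ℝ) → ℝ} (hf : IsPolyOfDegreeLE m f) (a : ℝ) :
    IsPolyOfDegreeLE m (fun x => a * f x) := by
  obtain ⟨c, hc, h⟩ := hf
  refine ⟨fun α => a * c α, fun α hα => by simp [hc α hα], fun x => ?_⟩
  simp [h, Finset.mul_sum, mul_assoc]

lemma IsPolyOfDegreeLE.sum {m : ℕ} {κ : Type*} (s : Finset κ) {F : κ → (ι → ℝ) → ℝ}
    (hF : ∀ i ∈ s, IsPolyOfDegreeLE m (F i)) : IsPolyOfDegreeLE m (fun x => ∑ i ∈ s, F i x) := by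
  classical
  induction s using Finset.induction_on with
  | empty => exact ⟨0, by simp, by simp⟩
  | insert a s ha ih =>
    simp only [Finset.sum_insert ha]
    exact (hF a (by simp)).add (ih fun i hi => hF i (by simp [hi]))

lemma exists_pow_eq_sum_hermiteFn (b : Fin 3) :
    ∃ u : Fin 3 → ℝ, (∀ r, b < r → u r = 0) ∧ ∀ x : ℝ, x ^ (b : ℕ) = ∑ r, u r * hermiteFn r x := by
  fin_cases b
  · exact ⟨![1, 0, 0], fun r hr => by fin_cases r <;> simp_all, fun x => by
      simp [Fin.sum_univ_three]⟩
  · exact ⟨![0, 1, 0], fun r hr => by fin_cases r <;> simp_all, fun x => by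
      simp [Fin.sum_univ_three]⟩
  · exact ⟨![1, 0, √2], fun r hr => by fin_cases r <;> simp_all, fun x => by
      simp only [Fin.sum_univ_three, hermiteFn_two, hermiteFn_zero, hermiteFn_one]
      simp
      field_simp
      ring⟩

/-- Each power is expanded in Hermite polynomials of no larger degree. If the total degree of `α`
exceeds that of the monomial, some `α i` exceeds `β i` and its coefficient vanishes. -/
lemma isPolyOfDegreeLE_monomial {m : ℕ} (β : ι → ℕ) (h2 : ∀ i, β i ≤ 2) (hm : ∑ i, β i ≤ m) :
    IsPolyOfDegreeLE m (fun x => ∏ i, x i ^ β i) := by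
  choose u hu h using fun i => exists_pow_eq_sum_hermiteFn ⟨β i, Nat.lt_succ_of_le (h2 i)⟩
  refine ⟨fun α => ∏ i, u i (α i), fun α hα => ?_, fun x => ?_⟩
  · obtain ⟨i, -, hi⟩ := Finset.exists_lt_of_sum_lt (hm.trans_lt hα)
    exact Finset.prod_eq_zero (Finset.mem_univ i) (hu i _ hi)
  · simp only [hermiteProd, ← Finset.prod_mul_distrib]
    rw [← Fintype.prod_sum fun i r => u i r * hermiteFn r (x i)]
    exact Finset.prod_congr rfl fun i _ => h i (x i)

lemma isPolyOfDegreeLE_const (m : ℕ) (a : ℝ) : IsPolyOfDegreeLE m (fun _ : ι → ℝ => a) := by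
  simpa using (isPolyOfDegreeLE_monomial (m := m) (fun _ : ι => 0) (by simp) (by simp)).const_mul a

/-- The even moments of a polynomial of bounded degree are controlled by its second moment. -/
lemma IsPolyOfDegreeLE.integral_pow_le {m : ℕ} {f : (ι → ℝ) → ℝ} (hf : IsPolyOfDegreeLE m f)
    (k : ℕ) (hk : 1 ≤ k) :
    ∫ x, f x ^ (2 * k) ∂(gaussPi ι) ≤ ((72 * k) ^ m * ∫ x, f x ^ 2 ∂(gaussPi ι)) ^ k := by
  obtain ⟨c, hc, h⟩ := hf
  have hk' : (1 : ℝ) ≤ k := by exact_mod_cast hk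
  set q : ℝ := 72 * k with hq
  have hq1 : 1 ≤ q := by linarith
  have hs : √q ^ 2 = q := Real.sq_sqrt (by linarith)
  have hs0 : √q ≠ 0 := by positivity
  have hρ : (√q)⁻¹ ^ 2 * q = 1 := by rw [inv_pow, hs]; field_simp
  -- The coefficients are multiplied by `√q ^ degree` to cancel the damping; on degrees at most `m`
  -- this enlarges the sum of squares by at most `q^m`.
  have key := integral_sum_hermiteProd_pow_le k hk (√q)⁻¹ hρ fun α => c α * √q ^ hermiteDegree α
  have e : ∀ x, ∑ α, c α * √q ^ hermiteDegree α * ((√q)⁻¹ ^ hermiteDegree α * hermiteProd α x)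
      = f x := by
    intro x
    rw [h]
    refine Finset.sum_congr rfl fun α _ => ?_
    rw [inv_pow]
    field_simp
  simp only [e] at key
  refine key.trans (pow_le_pow_left₀ (by positivity) ?_ k)
  simp only [h]
  rw [integral_sum_hermiteProd_sq, Finset.mul_sum]
  refine Finset.sum_le_sum fun α _ => ?_
  rcases lt_or_ge m (hermiteDegree α) with hα | hα
  · simp [hc α hα]
  · rw [mul_pow, ← pow_mul, mul_comm (hermiteDegree α), pow_mul, hs, mul_comm]
    exact mul_le_mul_of_nonneg_right (pow_le_pow_right₀ hq1 hα) (sq_nonneg _)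

end

/-! ### The trace estimate as a polynomial -/

/-- `contract` consumes the leading index, so `j` is built by `cons` from the left while `p` stays
in the last slot through `snoc`. -/
lemma contract_eq_sum {d : ℕ} (n : ℕ) (A : Tensor (n + 1) d) (g : Fin n → Fin d → ℝ) (p : Fin d) :
    A.contract n g p = ∑ j : Fin n → Fin d, A.entry j p * ∏ t, g t (j t) := by
  induction n with
  | zero =>
    simp only [Tensor.contract, Tensor.entry, Finset.univ_unique, Finset.sum_singleton,
      Finset.univ_eq_empty, Finset.prod_empty, mul_one]
    congr 1
  | succ n ih =>
    rw [Tensor.contract, ih, ← (Fin.consEquiv fun _ => Fin d).sum_comp, Fintype.sum_prod_type_right]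
    refine Finset.sum_congr rfl fun j _ => ?_
    simp only [Tensor.entry, Tensor.modeMul, Finset.sum_mul, Fin.consEquiv_apply,
      Fin.prod_univ_succ, Fin.cons_zero, Fin.cons_succ, Fin.insertNth_zero',
      Fin.cons_snoc_eq_snoc_cons, mul_assoc]
    rfl

/-- The monomial with which the entry `a_{j₁,…,jₙ,p}` enters the trace estimate. -/
def traceMonomial {n d : ℕ} (a : (Fin n → Fin d) × Fin d) (x : Fin n × Fin d → ℝ) : ℝ :=
  ∏ t, x (t, a.1 t) * x (t, a.2)

/-- The trace estimate as a function on `Fin n × Fin d → ℝ`. -/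
def traceFn {n d : ℕ} (A : Tensor (n + 1) d) (x : Fin n × Fin d → ℝ) : ℝ :=
  traceEstimate A fun t i => x (t, i)

lemma traceFn_eq_sum {n d : ℕ} (A : Tensor (n + 1) d) (x : Fin n × Fin d → ℝ) :
    traceFn A x = ∑ a : (Fin n → Fin d) × Fin d, A.entry a.1 a.2 * traceMonomial a x := by
  rw [Fintype.sum_prod_type_right, traceFn, traceEstimate]
  refine Finset.sum_congr rfl fun p _ => ?_
  rw [contract_eq_sum, Finset.mul_sum]
  refine Finset.sum_congr rfl fun j _ => ?_
  rw [hadamard, traceMonomial, Finset.prod_mul_distrib]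
  ring

lemma measurable_traceFn {n d : ℕ} (A : Tensor (n + 1) d) : Measurable (traceFn A) := by
  simp only [funext (traceFn_eq_sum A), traceMonomial]
  fun_prop

/-- The exponent of the variable `(t, i)` in `traceMonomial a`. -/
def traceExponent {n d : ℕ} (a : (Fin n → Fin d) × Fin d) (ti : Fin n × Fin d) : ℕ :=
  (if a.1 ti.1 = ti.2 then 1 else 0) + if a.2 = ti.2 then 1 else 0

lemma traceMonomial_eq_prod {n d : ℕ} (a : (Fin n → Fin d) × Fin d) (x : Fin n × Fin d → ℝ) :
    traceMonomial a x = ∏ ti, x ti ^ traceExponent a ti := by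
  rw [Fintype.prod_prod_type, traceMonomial]
  refine Finset.prod_congr rfl fun t _ => ?_
  simp only [traceExponent, pow_add, Finset.prod_mul_distrib, pow_ite, pow_one, pow_zero]
  simp

lemma hasAllMoments_traceMonomial {n d : ℕ} (a : (Fin n → Fin d) × Fin d) :
    HasAllMoments (traceMonomial a) (gaussPi (Fin n × Fin d)) :=
  HasAllMoments.prod _ fun _ _ => (hasAllMoments_eval _).mul (hasAllMoments_eval _)

lemma hasAllMoments_traceFn {n d : ℕ} (A : Tensor (n + 1) d) :
    HasAllMoments (traceFn A) (gaussPi (Fin n × Fin d)) := by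
  rw [funext (traceFn_eq_sum A)]
  exact HasAllMoments.sum _ fun a _ => (hasAllMoments_traceMonomial a).const_mul _

/-! ### Second moments -/

/-- Isserlis' formula for four coordinates of a standard Gaussian vector. -/
def isserlis {κ : Type*} [DecidableEq κ] (a b c e : κ) : ℝ :=
  (if a = b then 1 else 0) * (if c = e then 1 else 0) +
  (if a = c then 1 else 0) * (if b = e then 1 else 0) +
  (if a = e then 1 else 0) * (if b = c then 1 else 0)

lemma isserlis_swap {κ : Type*} [DecidableEq κ] (a b c e : κ) :
    isserlis a b c e = isserlis c e a b := by
  simp only [isserlis, @eq_comm _ c a, @eq_comm _ e b, @eq_comm _ e a, @eq_comm _ c b]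
  ring

/-- If the four indices do not form two pairs, some index occurs exactly once and its zero first
moment kills the product. Two pairs give 3 when they coincide, and 1 otherwise. -/
lemma prod_gaussMoment_four {κ : Type*} [Fintype κ] [DecidableEq κ] (a b c e : κ) :
    ∏ i, gaussMoment ((if a = i then 1 else 0) + (if b = i then 1 else 0) +
      ((if c = i then 1 else 0) + if e = i then 1 else 0)) = isserlis a b c e := by
  have zero : ∀ (f : κ → ℕ) (i : κ), f i = 1 → ∏ i, gaussMoment (f i) = 0 := fun f i h =>
    Finset.prod_eq_zero (Finset.mem_univ i) (by rw [h, gaussMoment_one])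
  have pairs : ∀ u v : κ, ∏ i, gaussMoment ((if u = i then 2 else 0) + if v = i then 2 else 0) =
      if u = v then 3 else 1 := by
    intro u v
    split_ifs with h
    · subst h
      rw [Finset.prod_eq_single u (fun i _ hi => by simp [hi.symm]) (by simp)]
      simp
    · refine Finset.prod_eq_one fun i _ => ?_
      by_cases h1 : u = i
      · subst h1; simp [Ne.symm h]
      · by_cases h2 : v = i <;> simp [h1, h2]
  have two : ∀ u i : κ, (if u = i then 1 else 0) + (if u = i then 1 else 0) =
      if u = i then 2 else 0 := fun u i => by split_ifs <;> rfl
  by_cases hab : a = b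
  · subst hab
    by_cases hce : c = e
    · subst hce
      simp only [two, pairs, isserlis]
      split_ifs <;> norm_num
    · rcases ne_or_eq c a with hc | rfl
      · rw [zero _ c (by simp [hc.symm, Ne.symm hce])]
        simp only [isserlis, hce, hc.symm]; simp
      · rw [zero _ e (by simp [hce])]
        simp [isserlis, hce]
  · by_cases hac : a = c
    · subst hac
      by_cases hbe : b = e
      · subst hbe
        rw [Finset.prod_congr rfl fun i _ => congrArg gaussMoment
          (show _ = (if a = i then 2 else 0) + if b = i then 2 else 0 by
            split_ifs <;> rfl), pairs]
        simp [isserlis, hab]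
      · rw [zero _ b (by simp [hab, Ne.symm hbe])]
        simp [isserlis, hab, hbe, Ne.symm hab]
    · by_cases hae : a = e
      · subst hae
        by_cases hbc : b = c
        · subst hbc
          rw [Finset.prod_congr rfl fun i _ => congrArg gaussMoment
            (show _ = (if a = i then 2 else 0) + if b = i then 2 else 0 by
              split_ifs <;> rfl), pairs]
          simp [isserlis, hab]
        · rw [zero _ b (by simp [hab, Ne.symm hbc])]
          simp [isserlis, hab, hac, hbc]
      · rw [zero _ a (by simp [Ne.symm hab, Ne.symm hac, Ne.symm hae])]
        simp [isserlis, hab, hac, hae]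

lemma integral_monomial {ι : Type*} [Fintype ι] (β : ι → ℕ) :
    ∫ x, ∏ i, x i ^ β i ∂(gaussPi ι) = ∏ i, gaussMoment (β i) :=
  integral_fintype_prod_eq_prod fun i y => y ^ β i

variable {n d : ℕ}

lemma integral_traceMonomial_mul (a b : (Fin n → Fin d) × Fin d) :
    ∫ x, traceMonomial a x * traceMonomial b x ∂(gaussPi (Fin n × Fin d)) =
      ∏ t, isserlis (a.1 t) a.2 (b.1 t) b.2 := by
  simp only [traceMonomial_eq_prod, ← Finset.prod_mul_distrib, ← pow_add]
  rw [integral_monomial, Fintype.prod_prod_type]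
  refine Finset.prod_congr rfl fun t _ => ?_
  rw [← prod_gaussMoment_four]
  rfl

/-- The mean of `traceMonomial a`. -/
def diagInd (a : (Fin n → Fin d) × Fin d) : ℝ := ∏ t, if a.1 t = a.2 then 1 else 0

lemma integral_traceMonomial (a : (Fin n → Fin d) × Fin d) :
    ∫ x, traceMonomial a x ∂(gaussPi (Fin n × Fin d)) = diagInd a := by
  simp only [traceMonomial_eq_prod]
  rw [integral_monomial, Fintype.prod_prod_type]
  refine Finset.prod_congr rfl fun t _ => ?_
  simp only [traceExponent]
  split_ifs with h
  · refine Finset.prod_eq_one fun i _ => ?_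
    rw [h]
    split_ifs <;> simp
  · refine Finset.prod_eq_zero (Finset.mem_univ a.2) ?_
    simp [h]

lemma diagInd_eq_ite (a : (Fin n → Fin d) × Fin d) :
    diagInd a = if a.1 = fun _ => a.2 then 1 else 0 := by
  rw [diagInd, Finset.prod_boole]
  simp [funext_iff]

lemma entry_const (A : Tensor (n + 1) d) (p : Fin d) :
    A.entry (fun _ => p) p = A fun _ => p := by
  rw [Tensor.entry]
  congr 1
  funext i
  refine Fin.lastCases ?_ (fun i => ?_) i <;> simp

lemma sum_entry_mul_diagInd (A : Tensor (n + 1) d) :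
    ∑ a : (Fin n → Fin d) × Fin d, A.entry a.1 a.2 * diagInd a = A.trace := by
  rw [Fintype.sum_prod_type_right, Tensor.trace]
  refine Finset.sum_congr rfl fun p _ => ?_
  simp [diagInd_eq_ite, entry_const]

lemma sum_entry_sq (A : Tensor (n + 1) d) :
    ∑ a : (Fin n → Fin d) × Fin d, A.entry a.1 a.2 ^ 2 = A.frobeniusNorm ^ 2 := by
  rw [Tensor.frobeniusNorm, Real.sq_sqrt (by positivity),
    ← (Fin.snocEquiv fun _ => Fin d).sum_comp, Fintype.sum_prod_type, Fintype.sum_prod_type_right]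
  rfl

lemma integral_traceFn (A : Tensor (n + 1) d) :
    ∫ x, traceFn A x ∂(gaussPi (Fin n × Fin d)) = A.trace := by
  simp only [traceFn_eq_sum]
  rw [integral_finsetSum _ fun a _ => ((hasAllMoments_traceMonomial a).const_mul _).integrable]
  simp only [integral_const_mul, integral_traceMonomial, sum_entry_mul_diagInd]

lemma integral_traceFn_sq (A : Tensor (n + 1) d) :
    ∫ x, traceFn A x ^ 2 ∂(gaussPi (Fin n × Fin d)) =
      ∑ a : (Fin n → Fin d) × Fin d, ∑ b : (Fin n → Fin d) × Fin d,
        A.entry a.1 a.2 * A.entry b.1 b.2 * ∏ t, isserlis (a.1 t) a.2 (b.1 t) b.2 := by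
  simp only [traceFn_eq_sum, pow_two, Finset.sum_mul_sum]
  have hi : ∀ a b : (Fin n → Fin d) × Fin d, HasAllMoments (fun x =>
      A.entry a.1 a.2 * traceMonomial a x * (A.entry b.1 b.2 * traceMonomial b x))
      (gaussPi (Fin n × Fin d)) := fun a b =>
    ((hasAllMoments_traceMonomial a).const_mul _).mul ((hasAllMoments_traceMonomial b).const_mul _)
  rw [integral_finsetSum _ fun a _ => (HasAllMoments.sum _ fun b _ => hi a b).integrable]
  refine Finset.sum_congr rfl fun a _ => ?_
  rw [integral_finsetSum _ fun b _ => (hi a b).integrable]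
  refine Finset.sum_congr rfl fun b _ => ?_
  refine (integral_congr_ae (Filter.Eventually.of_forall fun x =>
    mul_mul_mul_comm _ _ _ _)).trans ?_
  rw [integral_const_mul, integral_traceMonomial_mul]

lemma variance_traceFn (A : Tensor (n + 1) d) :
    variance (traceFn A) (gaussPi (Fin n × Fin d)) =
      (∑ a : (Fin n → Fin d) × Fin d, ∑ b : (Fin n → Fin d) × Fin d,
        A.entry a.1 a.2 * A.entry b.1 b.2 * ∏ t, isserlis (a.1 t) a.2 (b.1 t) b.2)
        - A.trace ^ 2 := by
  rw [variance_eq_sub (hasAllMoments_traceFn A).memLp_two, ← integral_traceFn_sq,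
    ← integral_traceFn]
  rfl

/-! ### The exact variance -/

lemma sum_sum_eq_diag_add_two_mul (f : Fin d → Fin d → ℝ) (hf : ∀ p q, f p q = f q p) :
    ∑ p, ∑ q, f p q = ∑ p, f p p + 2 * ∑ p, ∑ q with q < p, f p q := by
  have h : ∀ p q, f p q = (if q < p then f p q else 0) + (if p = q then f p q else 0) +
      if p < q then f q p else 0 := by
    intro p q
    rcases lt_trichotomy p q with h | h | h
    · simp [h, h.not_gt, h.ne, hf p q]
    · simp [h]
    · simp [h, h.not_gt, h.ne']
  simp only [Finset.sum_filter]
  rw [Finset.sum_congr rfl fun p _ => Finset.sum_congr rfl fun q _ => h p q]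
  simp only [Finset.sum_add_distrib]
  rw [Finset.sum_comm (f := fun p q => if p < q then f q p else 0)]
  simp
  ring

lemma sum_isserlis_diag (A : Tensor (n + 1) d) (p : Fin d) :
    ∑ j : Fin n → Fin d, ∑ k : Fin n → Fin d,
      A.entry j p * A.entry k p * ∏ t, isserlis (j t) p (k t) p =
    ∑ s ∈ Finset.range (n + 1), (3 : ℝ) ^ s *
      ∑ j : Fin n → Fin d with (Finset.univ.filter (fun t => j t = p)).card = s,
        A.entry j p ^ 2 := by
  have h1 : ∀ j k : Fin n → Fin d, ∏ t, isserlis (j t) p (k t) p =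
      if j = k then (3 : ℝ) ^ (Finset.univ.filter (fun t => j t = p)).card else 0 := by
    intro j k
    -- With equal last indices all three pairings contribute when `j t = k t = p`, but only one when
    -- `j t = k t ≠ p`.
    have : ∀ t, isserlis (j t) p (k t) p =
        if j t = k t then (if j t = p then (3 : ℝ) else 1) else 0 := by
      intro t
      simp only [isserlis]
      by_cases h : j t = k t
      · rw [← h]
        by_cases h' : j t = p
        · simp [h']; norm_num
        · simp [h']
      · by_cases h' : j t = p
        · have : k t ≠ p := fun h'' => h (h'.trans h''.symm)
          simp [h', this, this.symm]
        · simp [h, h']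
    simp only [this]
    rw [Finset.prod_ite_zero, Finset.prod_ite]
    simp [funext_iff]
  simp only [h1]
  have h2 : ∀ j : Fin n → Fin d, ∑ k : Fin n → Fin d, A.entry j p * A.entry k p *
      (if j = k then (3 : ℝ) ^ (Finset.univ.filter (fun t => j t = p)).card else 0) =
      (3 : ℝ) ^ (Finset.univ.filter (fun t => j t = p)).card * A.entry j p ^ 2 := by
    intro j
    simp
    ring
  simp only [h2]
  rw [← Finset.sum_fiberwise_of_maps_to (s := Finset.univ) (t := Finset.range (n + 1))
    (g := fun j : Fin n → Fin d => (Finset.univ.filter (fun t => j t = p)).card)]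
  · refine Finset.sum_congr rfl fun s _ => ?_
    rw [Finset.mul_sum]
    refine Finset.sum_congr rfl fun j hj => ?_
    rw [(Finset.mem_filter.1 hj).2]
  · intro j _
    have := Finset.card_le_univ (Finset.univ.filter (fun t => j t = p))
    simp only [Fintype.card_fin] at this
    simpa [Nat.lt_succ_iff] using this

lemma sum_isserlis_offDiag (A : Tensor (n + 1) d) {p q : Fin d} (hpq : p ≠ q) :
    ∑ j : Fin n → Fin d, ∑ k : Fin n → Fin d,
      A.entry j p * A.entry k q * ∏ t, isserlis (j t) p (k t) q =
    ∑ jk : (Fin n → Fin d) × (Fin n → Fin d) with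
      (∀ t, jk.1 t = p ∨ jk.1 t = q) ∧ (∀ t, jk.2 t = p ∨ jk.2 t = q) ∧
        (∀ t, jk.1 t ≠ jk.2 t), A.entry jk.1 p * A.entry jk.2 q := by
  rw [Finset.sum_filter, Fintype.sum_prod_type]
  refine Finset.sum_congr rfl fun j _ => Finset.sum_congr rfl fun k _ => ?_
  -- Since `p ≠ q`, the pairing that matches the two last indices is void; the others say that `(j
  -- t, k t)` is `(p, q)` or `(q, p)`.
  have : ∀ t, isserlis (j t) p (k t) q =
      if (j t = p ∨ j t = q) ∧ (k t = p ∨ k t = q) ∧ j t ≠ k t then 1 else 0 := by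
    intro t
    generalize j t = u
    generalize k t = v
    simp only [isserlis]
    by_cases h1 : u = p
    · subst h1
      by_cases h2 : v = q
      · subst h2; simp [hpq]
      · by_cases h3 : v = u
        · subst h3; simp [hpq]
        · simp [hpq, h2, h3]
    · by_cases h2 : u = q
      · subst h2
        by_cases h3 : v = p
        · subst h3; simp [hpq, h1]
        · by_cases h4 : v = u
          · subst h4; simp [hpq, h1]
          · simp [hpq, h1, h3, h4, Ne.symm h3]
      · simp [hpq, h1, h2]
  simp only [this]
  rw [Finset.prod_boole, mul_ite, mul_one, mul_zero]
  simp only [Finset.mem_univ, true_imp_iff, forall_and]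

lemma variance_traceFn_eq (A : Tensor (n + 1) d) :
    variance (traceFn A) (gaussPi (Fin n × Fin d)) =
      ∑ p : Fin d,
          ((∑ s ∈ Finset.range (n + 1), (3 : ℝ) ^ s *
              ∑ j : Fin n → Fin d with (Finset.univ.filter (fun t => j t = p)).card = s,
                A.entry j p ^ 2)
            - A (fun _ => p) ^ 2)
        + 2 * ∑ p : Fin d, ∑ q : Fin d with q < p,
          ((∑ jk : (Fin n → Fin d) × (Fin n → Fin d) with
              (∀ t, jk.1 t = p ∨ jk.1 t = q) ∧ (∀ t, jk.2 t = p ∨ jk.2 t = q) ∧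
                (∀ t, jk.1 t ≠ jk.2 t),
              A.entry jk.1 p * A.entry jk.2 q)
            - A (fun _ => p) * A (fun _ => q)) := by
  set H : Fin d → Fin d → ℝ := fun p q => ∑ j : Fin n → Fin d, ∑ k : Fin n → Fin d,
      A.entry j p * A.entry k q * ∏ t, isserlis (j t) p (k t) q with hH
  have hsymm : ∀ p q, H p q - A (fun _ => p) * A (fun _ => q) =
      H q p - A (fun _ => q) * A (fun _ => p) := by
    intro p q
    rw [mul_comm (A fun _ => p)]
    congr 1
    simp only [hH]
    rw [Finset.sum_comm]
    refine Finset.sum_congr rfl fun k _ => Finset.sum_congr rfl fun j _ => ?_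
    rw [mul_comm (A.entry j p)]
    congr 1
    exact Finset.prod_congr rfl fun t _ => isserlis_swap _ _ _ _
  have hv : variance (traceFn A) (gaussPi (Fin n × Fin d)) =
      ∑ p, ∑ q, (H p q - A (fun _ => p) * A (fun _ => q)) := by
    rw [variance_traceFn]
    simp only [Finset.sum_sub_distrib]
    congr 1
    · simp only [Fintype.sum_prod_type_right, hH]
      refine Finset.sum_congr rfl fun p _ => ?_
      rw [Finset.sum_comm]
    · rw [Tensor.trace, pow_two, Finset.sum_mul_sum]
  rw [hv, sum_sum_eq_diag_add_two_mul _ hsymm]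
  congr 1
  · refine Finset.sum_congr rfl fun p _ => ?_
    simp only [hH]
    rw [sum_isserlis_diag, pow_two]
  · congr 1
    refine Finset.sum_congr rfl fun p _ => Finset.sum_congr rfl fun q hq => ?_
    simp only [hH]
    rw [sum_isserlis_offDiag A (Finset.mem_filter.1 hq).2.ne']

/-! ### The variance bound -/

lemma sum_isserlis (a b e : Fin d) : ∑ l, isserlis a b l e =
    (if a = b then 1 else 0) + (if b = e then 1 else 0) + if a = e then 1 else 0 := by
  simp [isserlis, Finset.sum_add_distrib]

/-- The first pairing in Isserlis' formula is the product of the means. The monomials are thus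
nonnegatively correlated, as the Schur test requires. -/
lemma diagInd_mul_le (a b : (Fin n → Fin d) × Fin d) :
    diagInd a * diagInd b ≤ ∏ t, isserlis (a.1 t) a.2 (b.1 t) b.2 := by
  rw [diagInd, diagInd, ← Finset.prod_mul_distrib]
  refine Finset.prod_le_prod (fun t _ => by positivity) fun t _ => ?_
  rw [isserlis, add_assoc]
  exact le_add_of_nonneg_right (by positivity)

lemma sum_diagInd : ∑ b : (Fin n → Fin d) × Fin d, diagInd b = d := by
  rw [Fintype.sum_prod_type_right]
  simp [diagInd_eq_ite]

lemma sum_prod_isserlis (a : (Fin n → Fin d) × Fin d) :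
    ∑ b : (Fin n → Fin d) × Fin d, ∏ t, isserlis (a.1 t) a.2 (b.1 t) b.2 =
      ∑ q, ∏ t, ((if a.1 t = a.2 then 1 else 0) + (if a.2 = q then 1 else 0) +
        if a.1 t = q then (1 : ℝ) else 0) := by
  rw [Fintype.sum_prod_type_right]
  refine Finset.sum_congr rfl fun q _ => ?_
  simp only [← sum_isserlis]
  rw [← Fintype.prod_sum fun t l => isserlis (a.1 t) a.2 l q]

lemma prod_le_apply_mul_pow (f : Fin n → ℝ) (t₀ : Fin n) (M : ℝ) (h0 : ∀ t, 0 ≤ f t)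
    (hM : ∀ t, f t ≤ M) : ∏ t, f t ≤ f t₀ * M ^ (n - 1) := by
  rw [← Finset.mul_prod_erase _ _ (Finset.mem_univ t₀)]
  refine mul_le_mul_of_nonneg_left ?_ (h0 t₀)
  refine (Finset.prod_le_prod (fun t _ => h0 t) fun t _ => hM t).trans (le_of_eq ?_)
  simp

/-- For diagonal `a` the row sum is exactly `3^n + (d - 1) - d`. Otherwise the means contribute
nothing, and a slot `t₀` with `a.1 t₀ ≠ a.2` has factor 1 at `q = a.2`, leaving at most `3^(n-1)`.
For other `q` all factors are at most 1 and the one at `t₀` selects `q = a.1 t₀`, adding at most 1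
in total. Finally `3^(n-1) + 1 ≤ 3^n - 1`. -/
lemma sum_covariance_le (a : (Fin n → Fin d) × Fin d) :
    ∑ b : (Fin n → Fin d) × Fin d,
      (∏ t, isserlis (a.1 t) a.2 (b.1 t) b.2 - diagInd a * diagInd b) ≤ (3 : ℝ) ^ n - 1 := by
  rw [Finset.sum_sub_distrib, ← Finset.mul_sum, sum_diagInd, sum_prod_isserlis, diagInd_eq_ite]
  split_ifs with h
  · have : ∀ q : Fin d, ∏ t : Fin n, ((if a.1 t = a.2 then 1 else 0) + (if a.2 = q then 1 else 0) +
        if a.1 t = q then (1 : ℝ) else 0) = (if a.2 = q then (3 : ℝ) ^ n - 1 else 0) + 1 := by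
      intro q
      simp only [h]
      split_ifs <;> norm_num
    simp [this, Finset.sum_add_distrib]
  · obtain ⟨t₀, ht₀⟩ : ∃ t, a.1 t ≠ a.2 := by
      by_contra hc
      push Not at hc
      exact h (funext hc)
    have hn : 1 ≤ n := by have := t₀.isLt; omega
    have key : ∀ q : Fin d, ∏ t : Fin n, ((if a.1 t = a.2 then 1 else 0) +
        (if a.2 = q then 1 else 0) + if a.1 t = q then (1 : ℝ) else 0) ≤
        (if a.2 = q then (3 : ℝ) ^ (n - 1) else 0) + if a.1 t₀ = q then 1 else 0 := by
      intro q
      by_cases hq : a.2 = q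
      · refine (prod_le_apply_mul_pow _ t₀ 3 (fun t => by positivity) fun t => ?_).trans ?_
        · split_ifs <;> norm_num
        · rw [← hq]
          simp [ht₀]
      · refine (prod_le_apply_mul_pow _ t₀ 1 (fun t => by positivity) fun t => ?_).trans ?_
        · by_cases h1 : a.1 t = a.2
          · simp [h1, hq]
          · simp only [h1, hq, if_false]
            split_ifs <;> norm_num
        · simp [ht₀, hq]
    refine (sub_le_sub_right (Finset.sum_le_sum fun q _ => key q) _).trans ?_
    simp only [Finset.sum_add_distrib, Finset.sum_ite_eq, Finset.mem_univ, if_true]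
    have h3 : (1 : ℝ) ≤ 3 ^ (n - 1) := one_le_pow₀ (by norm_num)
    have h4 : (3 : ℝ) ^ n = 3 ^ (n - 1) * 3 := by rw [← pow_succ, Nat.sub_add_cancel hn]
    linarith

/-- The Schur test for quadratic forms with a symmetric nonnegative matrix. -/
lemma sum_sum_mul_le_of_row_sum_le {κ : Type*} [Fintype κ] (M : κ → κ → ℝ) (w : κ → ℝ) (R : ℝ)
    (h0 : ∀ a b, 0 ≤ M a b) (hs : ∀ a b, M a b = M b a) (hR : ∀ a, ∑ b, M a b ≤ R) :
    ∑ a, ∑ b, w a * w b * M a b ≤ R * ∑ a, w a ^ 2 := by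
  have e1 : ∑ a, ∑ b, w b ^ 2 * M a b = ∑ a, ∑ b, w a ^ 2 * M a b := by
    rw [Finset.sum_comm]
    exact Finset.sum_congr rfl fun a _ => Finset.sum_congr rfl fun b _ => by rw [hs]
  calc ∑ a, ∑ b, w a * w b * M a b
      ≤ ∑ a, ∑ b, (w a ^ 2 * M a b + w b ^ 2 * M a b) / 2 := by
        refine Finset.sum_le_sum fun a _ => Finset.sum_le_sum fun b _ => ?_
        nlinarith [mul_nonneg (sq_nonneg (w a - w b)) (h0 a b)]
    _ = ∑ a, w a ^ 2 * ∑ b, M a b := by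
        simp only [← Finset.sum_div, Finset.sum_add_distrib, e1, Finset.mul_sum]
        ring
    _ ≤ R * ∑ a, w a ^ 2 := by
        rw [Finset.mul_sum]
        refine Finset.sum_le_sum fun a _ => ?_
        rw [mul_comm]
        exact mul_le_mul_of_nonneg_right (hR a) (sq_nonneg _)

lemma variance_traceFn_le (A : Tensor (n + 1) d) :
    variance (traceFn A) (gaussPi (Fin n × Fin d)) ≤ ((3 : ℝ) ^ n - 1) * A.frobeniusNorm ^ 2 := by
  rw [variance_traceFn, ← sum_entry_mul_diagInd, pow_two, Finset.sum_mul_sum, ← sum_entry_sq]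
  refine le_trans (le_of_eq ?_) (sum_sum_mul_le_of_row_sum_le
    (fun a b : (Fin n → Fin d) × Fin d =>
      ∏ t, isserlis (a.1 t) a.2 (b.1 t) b.2 - diagInd a * diagInd b)
    (fun a => A.entry a.1 a.2) _ (fun a b => sub_nonneg.2 (diagInd_mul_le a b))
    (fun a b => ?_) sum_covariance_le)
  · simp only [← Finset.sum_sub_distrib]
    refine Finset.sum_congr rfl fun a _ => Finset.sum_congr rfl fun b _ => ?_
    ring
  · rw [mul_comm (diagInd a)]
    congr 1
    exact Finset.prod_congr rfl fun t _ => isserlis_swap _ _ _ _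

/-! ### The mean of independent copies -/

/-- The mean of `K` trace estimates, as a function of all the Gaussian entries. -/
def meanFn (A : Tensor (n + 1) d) (K : ℕ) (x : Fin K × Fin n × Fin d → ℝ) : ℝ :=
  (1 / (K : ℝ)) * ∑ k : Fin K, traceFn A fun ti => x (k, ti)

/-- Each monomial involves the variables of one copy only, so averaging leaves the degree at `2n`,
whatever `K` is. -/
lemma isPolyOfDegreeLE_meanFn_sub (A : Tensor (n + 1) d) (K : ℕ) (c : ℝ) :
    IsPolyOfDegreeLE (2 * n) fun x => meanFn A K x - c := by
  simp only [meanFn, sub_eq_add_neg, traceFn_eq_sum]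
  refine ((IsPolyOfDegreeLE.sum _ fun k _ => IsPolyOfDegreeLE.sum _ fun a _ =>
    IsPolyOfDegreeLE.const_mul ?_ _).const_mul _).add (isPolyOfDegreeLE_const _ _)
  have h : (fun x : Fin K × Fin n × Fin d → ℝ => traceMonomial a fun ti => x (k, ti)) =
      fun x => ∏ i : Fin K × Fin n × Fin d, x i ^ (if k = i.1 then traceExponent a i.2 else 0) := by
    funext x
    rw [traceMonomial_eq_prod]
    refine Eq.trans ?_ (Fintype.prod_prod_type_right _).symm
    refine Finset.prod_congr rfl fun ti _ => ?_
    simp only [pow_ite, pow_zero]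
    simp
  rw [h]
  refine isPolyOfDegreeLE_monomial _ (fun i => ?_) (le_of_eq ?_)
  · simp only [traceExponent]
    split_ifs <;> norm_num
  · rw [Fintype.sum_prod_type_right]
    simp only [Finset.sum_ite_eq, Finset.mem_univ, if_true]
    rw [Fintype.sum_prod_type]
    simp [traceExponent, Finset.sum_add_distrib, mul_comm]

lemma iIndepFun_eval (ι : Type*) [Fintype ι] :
    iIndepFun (fun (i : ι) (x : ι → ℝ) => x i) (gaussPi ι) :=
  iIndepFun_pi (X := fun _ y => y) fun _ => aemeasurable_id

lemma hasLaw_copy (K : ℕ) (k : Fin K) :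
    HasLaw (fun (x : Fin K × Fin n × Fin d → ℝ) ti => x (k, ti)) (gaussPi (Fin n × Fin d))
      (gaussPi (Fin K × Fin n × Fin d)) :=
  iIndepFun.hasLaw_pi
    (fun ti => (measurePreserving_eval (fun _ => gaussianReal 0 1) (k, ti)).hasLaw)
    ((iIndepFun_eval _).precomp (Prod.mk_right_injective k))

lemma hasAllMoments_copy (A : Tensor (n + 1) d) (K : ℕ) (k : Fin K) :
    HasAllMoments (fun x : Fin K × Fin n × Fin d → ℝ => traceFn A fun ti => x (k, ti))
      (gaussPi (Fin K × Fin n × Fin d)) :=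
  (hasAllMoments_traceFn A).comp_hasLaw (hasLaw_copy K k)

lemma integral_copy (A : Tensor (n + 1) d) (K : ℕ) (k : Fin K) :
    ∫ x, traceFn A (fun ti => x (k, ti)) ∂(gaussPi (Fin K × Fin n × Fin d)) = A.trace := by
  rw [← integral_traceFn]
  exact (hasLaw_copy K k).integral_comp (measurable_traceFn A).aestronglyMeasurable

lemma variance_copy (A : Tensor (n + 1) d) (K : ℕ) (k : Fin K) :
    variance (fun x => traceFn A fun ti => x (k, ti)) (gaussPi (Fin K × Fin n × Fin d)) =
      variance (traceFn A) (gaussPi (Fin n × Fin d)) := by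
  rw [← (hasLaw_copy K k).map_eq, variance_map (measurable_traceFn A).aemeasurable
    (hasLaw_copy K k).aemeasurable]
  rfl

lemma indepFun_copy (A : Tensor (n + 1) d) (K : ℕ) {k l : Fin K} (hkl : k ≠ l) :
    IndepFun (fun x : Fin K × Fin n × Fin d → ℝ => traceFn A fun ti => x (k, ti))
      (fun x => traceFn A fun ti => x (l, ti)) (gaussPi (Fin K × Fin n × Fin d)) := by
  have h := (iIndepFun_eval (Fin K × Fin n × Fin d)).indepFun_finset
    ({k} ×ˢ Finset.univ) ({l} ×ˢ Finset.univ) (Finset.disjoint_product.2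
      (Or.inl (Finset.disjoint_singleton.2 hkl))) fun i => measurable_pi_apply i
  have hm : ∀ m : Fin K, Measurable fun y : ({m} ×ˢ Finset.univ : Finset (Fin K × Fin n × Fin d)) → ℝ =>
      traceFn A fun ti => y ⟨(m, ti), by simp⟩ := fun m =>
    (measurable_traceFn A).comp (measurable_pi_lambda _ fun ti => measurable_pi_apply _)
  exact h.comp (hm k) (hm l)

lemma integral_meanFn (A : Tensor (n + 1) d) {K : ℕ} (hK : 0 < K) :
    ∫ x, meanFn A K x ∂(gaussPi (Fin K × Fin n × Fin d)) = A.trace := by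
  simp only [meanFn]
  rw [integral_const_mul, integral_finsetSum _ fun k _ => (hasAllMoments_copy A K k).integrable]
  simp only [integral_copy]
  have : (K : ℝ) ≠ 0 := by positivity
  simp
  field_simp

lemma variance_meanFn (A : Tensor (n + 1) d) {K : ℕ} (hK : 0 < K) :
    variance (meanFn A K) (gaussPi (Fin K × Fin n × Fin d)) =
      variance (traceFn A) (gaussPi (Fin n × Fin d)) / K := by
  have h := IndepFun.variance_sum (μ := gaussPi (Fin K × Fin n × Fin d)) (s := Finset.univ)
    (X := fun (k : Fin K) x => traceFn A fun ti => x (k, ti))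
    (fun k _ => (hasAllMoments_copy A K k).memLp_two) (fun k _ l _ hkl => indepFun_copy A K hkl)
  simp only [variance_copy] at h
  have e : meanFn A K = fun x => (1 / (K : ℝ)) *
      (∑ k : Fin K, fun x : Fin K × Fin n × Fin d → ℝ => traceFn A fun ti => x (k, ti)) x := by
    funext x
    simp [meanFn]
  have : (K : ℝ) ≠ 0 := by positivity
  rw [e, variance_const_mul, h]
  simp
  field_simp

lemma integral_meanFn_sub_sq_le (A : Tensor (n + 1) d) {K : ℕ} (hK : 0 < K) :
    ∫ x, (meanFn A K x - A.trace) ^ 2 ∂(gaussPi (Fin K × Fin n × Fin d)) ≤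
      ((3 : ℝ) ^ n - 1) * A.frobeniusNorm ^ 2 / K := by
  have hm : HasAllMoments (meanFn A K) (gaussPi (Fin K × Fin n × Fin d)) := by
    simpa using (isPolyOfDegreeLE_meanFn_sub A K 0).hasAllMoments
  have h := variance_eq_integral hm.memLp_two.aemeasurable
  rw [integral_meanFn A hK, variance_meanFn A hK] at h
  rw [← h]
  exact div_le_div_of_nonneg_right (variance_traceFn_le A) (Nat.cast_nonneg K)

/-! ### Concentration -/

/-- Markov's inequality for an even moment. -/
lemma one_sub_le_of_integral_pow_le {Ω : Type*} [MeasurableSpace Ω] {μ : Measure Ω}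
    [IsProbabilityMeasure μ] {Z : Ω → ℝ} (hZ : HasAllMoments Z μ) (hZm : Measurable Z)
    {t δ : ℝ} (ht : 0 < t) (k : ℕ) (h : ∫ x, Z x ^ (2 * k) ∂μ ≤ δ * t ^ (2 * k)) :
    1 - δ ≤ μ.real {x | |Z x| ≤ t} := by
  have h1 := mul_meas_ge_le_integral_of_nonneg (μ := μ) (f := fun x => Z x ^ (2 * k))
    (Filter.Eventually.of_forall fun x => (even_two_mul k).pow_nonneg _) (hZ.pow _).integrable
    (t ^ (2 * k))
  have hms : MeasurableSet {x | |Z x| ≤ t} :=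
    measurableSet_le (continuous_abs.measurable.comp hZm) measurable_const
  have hsub : {x | |Z x| ≤ t}ᶜ ⊆ {x | t ^ (2 * k) ≤ Z x ^ (2 * k)} := by
    intro x hx
    have hx' : t < |Z x| := by simpa using hx
    have := pow_le_pow_left₀ ht.le hx'.le (2 * k)
    rwa [(even_two_mul k).pow_abs] at this
  have h2 := measureReal_mono (μ := μ) hsub
  rw [probReal_compl_eq_one_sub hms] at h2
  have ht' : 0 < t ^ (2 * k) := by positivity
  have h3 : t ^ (2 * k) * (1 - μ.real {x | |Z x| ≤ t}) ≤ t ^ (2 * k) * δ :=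
    ((mul_le_mul_of_nonneg_left h2 ht'.le).trans h1).trans (h.trans_eq (mul_comm _ _))
  have := le_of_mul_le_mul_left h3 ht'
  linarith

/-- A polynomial of degree `2n` in Gaussians whose variance is small enough is concentrated. -/
lemma IsPolyOfDegreeLE.one_sub_le {ι : Type*} [Fintype ι] [DecidableEq ι] {Z : (ι → ℝ) → ℝ}
    (hZ : IsPolyOfDegreeLE (2 * n) Z) (hZm : Measurable Z) {t δ : ℝ} (ht : 0 < t) (hδ : 0 < δ)
    (hδ1 : δ < 1)
    (h : Real.exp 144 * ((∫ x, Z x ^ 2 ∂(gaussPi ι)) * (2 + Real.log (1 / δ)) ^ (2 * n)) ≤ t ^ 2) :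
    1 - δ ≤ (gaussPi ι).real {x | |Z x| ≤ t} := by
  set L := 2 + Real.log (1 / δ) with hL
  set σ := ∫ x, Z x ^ 2 ∂(gaussPi ι) with hσ
  have hσ0 : 0 ≤ σ := integral_nonneg fun x => sq_nonneg _
  have hlog : 0 < Real.log (1 / δ) := Real.log_pos (by rw [lt_div_iff₀ hδ]; linarith)
  have hδL : δ = Real.exp (2 - L) := by
    rw [hL, one_div, Real.log_inv, show 2 - (2 + -Real.log δ) = Real.log δ by ring, Real.exp_log hδ]
  have h' : σ * L ^ (2 * n) ≤ Real.exp (-144) * t ^ 2 := by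
    rw [Real.exp_neg, ← div_eq_inv_mul, le_div_iff₀ (Real.exp_pos _), mul_comm]
    exact h
  -- For `L < 72` Chebyshev's inequality suffices, because `δ = exp (2 - L)` stays above `exp
  -- (-144)`.
  rcases lt_or_ge L 72 with hL72 | hL72
  · refine one_sub_le_of_integral_pow_le hZ.hasAllMoments hZm ht 1 ?_
    rw [mul_one, ← hσ]
    have h1 : 1 ≤ L ^ (2 * n) := one_le_pow₀ (by linarith)
    have h2 : Real.exp (-144) ≤ δ := by
      rw [hδL]
      exact Real.exp_le_exp.2 (by linarith)
    have h3 := mul_le_mul_of_nonneg_right h2 (sq_nonneg t)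
    nlinarith
  -- This `k` satisfies `72k ≤ L ≤ 144k`. The first inequality bounds the hypercontractive factor by
  -- `L^(2n)`; the second gives `exp (-144k) ≤ exp (-L) ≤ δ`, whence the constant `exp 144`.
  · set k := ⌊L / 72⌋₊ with hk
    have hk1 : 1 ≤ k := Nat.le_floor (by rw [Nat.cast_one, le_div_iff₀ (by norm_num)]; linarith)
    have hkL : (72 * k : ℝ) ≤ L := by
      have := Nat.floor_le (by linarith : 0 ≤ L / 72)
      rw [← hk] at this
      linarith
    have hkL' : L ≤ 144 * k := by
      have := Nat.lt_floor_add_one (L / 72)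
      rw [← hk] at this
      have : (1 : ℝ) ≤ k := by exact_mod_cast hk1
      linarith
    refine one_sub_le_of_integral_pow_le hZ.hasAllMoments hZm ht k
      ((hZ.integral_pow_le k hk1).trans ?_)
    have h1 : (72 * k : ℝ) ^ (2 * n) * σ ≤ Real.exp (-144) * t ^ 2 := by
      refine le_trans ?_ h'
      rw [mul_comm]
      exact mul_le_mul_of_nonneg_left (pow_le_pow_left₀ (by positivity) hkL _) hσ0
    refine (pow_le_pow_left₀ (by positivity) h1 k).trans ?_
    rw [mul_pow, ← pow_mul, ← Real.exp_nat_mul, hδL]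
    refine mul_le_mul_of_nonneg_right (Real.exp_le_exp.2 ?_) (by positivity)
    linarith

lemma measurable_meanFn (A : Tensor (n + 1) d) (K : ℕ) : Measurable (meanFn A K) := by
  unfold meanFn
  refine measurable_const.mul (Finset.measurable_sum _ fun k _ => ?_)
  exact (measurable_traceFn A).comp (measurable_pi_lambda _ fun ti => measurable_pi_apply _)

lemma one_sub_le_gaussPi_meanFn (A : Tensor (n + 1) d) (hA : A.trace ≠ 0) {ε δ : ℝ} (hε : 0 < ε)
    (hδ : 0 < δ) (hδ1 : δ < 1) {K : ℕ} (hK : 0 < K)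
    (hCK : Real.exp 144 * (((3 : ℝ) ^ n - 1) * A.frobeniusNorm ^ 2 *
      (2 + Real.log (1 / δ)) ^ (2 * n) / (ε ^ 2 * A.trace ^ 2)) ≤ K) :
    1 - δ ≤ (gaussPi (Fin K × Fin n × Fin d)).real {x | |meanFn A K x - A.trace| ≤ ε * |A.trace|} := by
  have ht : 0 < ε * |A.trace| := mul_pos hε (abs_pos.2 hA)
  have hK' : (0 : ℝ) < K := by exact_mod_cast hK
  refine (isPolyOfDegreeLE_meanFn_sub A K A.trace).one_sub_le
    ((measurable_meanFn A K).sub_const _) ht hδ hδ1 ?_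
  rw [mul_pow, sq_abs]
  have hσ := integral_meanFn_sub_sq_le A hK
  set σ := ∫ x, (meanFn A K x - A.trace) ^ 2 ∂(gaussPi (Fin K × Fin n × Fin d))
  set V := ((3 : ℝ) ^ n - 1) * A.frobeniusNorm ^ 2
  have hT : 0 < ε ^ 2 * A.trace ^ 2 := by positivity
  set L := (2 + Real.log (1 / δ)) ^ (2 * n)
  have hL : 0 ≤ L := (even_two_mul n).pow_nonneg _
  rw [← mul_div_assoc, div_le_iff₀ hT] at hCK
  rw [le_div_iff₀ hK'] at hσ
  refine le_of_mul_le_mul_left ?_ hK'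
  calc K * (Real.exp 144 * (σ * L)) = Real.exp 144 * (σ * K * L) := by ring
    _ ≤ Real.exp 144 * (V * L) := by gcongr
    _ ≤ _ := hCK

end TensorTrace

end

theorem mainTheorem6 :
    -- the variance of one estimate, for a tensor of order `N = n + 1`
    (∀ (n d : ℕ) (A : TensorTrace.Tensor (n + 1) d)
      (Ω : Type*) [MeasurableSpace Ω] (μ : Measure Ω) [IsProbabilityMeasure μ]
      (g : Fin n → Fin d → Ω → ℝ),
      (∀ t i, HasLaw (g t i) (gaussianReal 0 1) μ) →
      iIndepFun (fun ti : Fin n × Fin d => g ti.1 ti.2) μ →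
      (∀ t i, ∫ ω, g t i ω ^ 4 ∂μ = 3) ∧
      MemLp (fun ω => TensorTrace.traceEstimate A (fun t i => g t i ω)) 2 μ ∧
      variance (fun ω => TensorTrace.traceEstimate A (fun t i => g t i ω)) μ =
        ∑ p : Fin d,
          ((∑ s ∈ Finset.range (n + 1), (3 : ℝ) ^ s *
              ∑ j : Fin n → Fin d with (Finset.univ.filter (fun t => j t = p)).card = s,
                A.entry j p ^ 2)
            - A (fun _ => p) ^ 2)
        + 2 * ∑ p : Fin d, ∑ q : Fin d with q < p,
          ((∑ jk : (Fin n → Fin d) × (Fin n → Fin d) with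
              (∀ t, jk.1 t = p ∨ jk.1 t = q) ∧ (∀ t, jk.2 t = p ∨ jk.2 t = q) ∧
                (∀ t, jk.1 t ≠ jk.2 t),
              A.entry jk.1 p * A.entry jk.2 q)
            - A (fun _ => p) * A (fun _ => q)) ∧
      variance (fun ω => TensorTrace.traceEstimate A (fun t i => g t i ω)) μ ≤
        ((3 : ℝ) ^ n - 1) * A.frobeniusNorm ^ 2) ∧
    -- the sample size that suffices for the mean of `K` estimates, with an absolute constant
    (∃ C : ℝ, 0 < C ∧
      ∀ (n d : ℕ) (A : TensorTrace.Tensor (n + 1) d), A.trace ≠ 0 →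
      ∀ (ε δ : ℝ), 0 < ε → 0 < δ → δ < 1 →
      ∀ (K : ℕ), 0 < K →
      C * (((3 : ℝ) ^ n - 1) * A.frobeniusNorm ^ 2 * (2 + Real.log (1 / δ)) ^ (2 * n) /
        (ε ^ 2 * A.trace ^ 2)) ≤ (K : ℝ) →
      ∀ (Ω : Type*) [MeasurableSpace Ω] (μ : Measure Ω) [IsProbabilityMeasure μ]
        (g : Fin K → Fin n → Fin d → Ω → ℝ),
        (∀ k t i, HasLaw (g k t i) (gaussianReal 0 1) μ) →
        iIndepFun (fun kti : Fin K × Fin n × Fin d => g kti.1 kti.2.1 kti.2.2) μ →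
        TensorTrace.IsApproximation μ
          (fun ω => (1 / (K : ℝ)) *
            ∑ k : Fin K, TensorTrace.traceEstimate A (fun t i => g k t i ω))
          A.trace ε δ) := by
  refine ⟨fun n d A Ω _ μ _ g hg hind => ?_, Real.exp 144, Real.exp_pos _,
    fun n d A hA ε δ hε hδ hδ1 K hK hCK Ω _ μ _ g hg hind => ?_⟩
  -- Independence and the marginal laws make the joint law the product Gaussian measure, so all
  -- claims transfer from `gaussPi`.
  · have hlaw : HasLaw (fun ω (ti : Fin n × Fin d) => g ti.1 ti.2 ω)
        (TensorTrace.gaussPi (Fin n × Fin d)) μ := hind.hasLaw_pi fun ti => hg ti.1 ti.2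
    have hvar : variance (fun ω => TensorTrace.traceEstimate A (fun t i => g t i ω)) μ =
        variance (TensorTrace.traceFn A) (TensorTrace.gaussPi (Fin n × Fin d)) := by
      rw [← hlaw.map_eq, variance_map (TensorTrace.measurable_traceFn A).aemeasurable
        hlaw.aemeasurable]
      rfl
    refine ⟨fun t i => ?_, ((TensorTrace.hasAllMoments_traceFn A).comp_hasLaw hlaw).memLp_two,
      hvar.trans (TensorTrace.variance_traceFn_eq A),
      hvar.trans_le (TensorTrace.variance_traceFn_le A)⟩
    exact ((hg t i).integral_comp (f := fun x => x ^ 4)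
      (by fun_prop)).trans TensorTrace.gaussMoment_four
  · have hlaw : HasLaw (fun ω (kti : Fin K × Fin n × Fin d) => g kti.1 kti.2.1 kti.2.2 ω)
        (TensorTrace.gaussPi (Fin K × Fin n × Fin d)) μ :=
      hind.hasLaw_pi fun kti => hg kti.1 kti.2.1 kti.2.2
    refine (TensorTrace.one_sub_le_gaussPi_meanFn A hA hε hδ hδ1 hK hCK).trans (le_of_eq ?_)
    exact (hlaw.measureReal_eq (p := fun x =>
      |TensorTrace.meanFn A K x - A.trace| ≤ ε * |A.trace|)
      (measurableSet_le (continuous_abs.measurable.comp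
        ((TensorTrace.measurable_meanFn A K).sub_const _)) measurable_const)).symm
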